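/- Setting. Let $m\ge 1$ and $\mathcal X=\{x\in\mathbb R^d: Bx\le b,\ Cx\le c\}$ with $B\in\mathbb R^{d_1\times d}$, $b\in\mathbb R^{d_1}$, $C\in\mathbb R^{d_2\times d}$, $c\in\mathbb R^{d_2}$ (inequalities between vectors are componentwise). For $1\le j\le m$ let $\xi_j$ be a random element of a measurable space $\Xi_j$, $F_j:\mathcal X\times\Xi_j\to\mathbb R$ with $F_j(x;\xi_j)$ integrable for every $x\in\mathcal X$, $f_j(x)=\mathbb E[F_j(x;\xi_j)]$ and $f=\sum_{j=1}^m f_j$. Let $x^*$ be a minimizer of $f$ over $\mathcal X$ such that $Bx^*=b$ and $Cx^*<c$. Let $Q(z)=\arg\max_{x\in\mathcal X}\{\langle z,x\rangle-\tfrac12\|x\|^2\}$. Algorithm. Given (possibly random) $z_{j,0}\in\mathbb R^d$, random $m\times m$ weight matrices $A_k$, step sizes $\alpha_k$ and samples $\xi_{j,k}$, put for $k=1,2,\dots$ $$x_{j,k}=Q(z_{j,k-1}),\qquad z_{j,k}=\sum_{i:\,[A_k]_{ji}>0}[A_k]_{ji}\,z_{i,k-1}-\alpha_k\nabla F_j(x_{j,k};\xi_{j,k}),$$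 $\bar z_k=\frac1m\sum_{j=1}^m z_{j,k}$, $\bar x_{k+1}=Q(\bar z_k)$, and $\mathcal F_k=\sigma(z_{j,0},\xi_{j,t},A_t:\ 1\le j\le m,\ 1\le t\le k-1)$. Assumptions. 1. For every $j$ and every $s\in\Xi_j$, $F_j(\cdot;s)$ is convex and differentiable on $\mathcal X$, its gradient $\nabla F_j(x;s)$ is a measurable function of $(x,s)$, and $|F_j(x;s)-F_j(y;s)|\le L_{0,j}(s)\|x-y\|$ for $x,y\in\mathcal X$, where $L_{0,j}$ is measurable and $\mathbb E[|L_{0,j}(\xi_j)|^p]<\infty$ for some $p\ge2$. 2. Each $\nabla f_j$ is Lipschitz on $\mathcal X$, and there are $c_0,\epsilon>0$ with $\|\nabla f(x)-\nabla f(x^*)-\nabla^2f(x^*)(x-x^*)\|\le c_0\|x-x^*\|^2$ for all $x\in\mathcal X$ with $\|x-x^*\|\le\epsilon$. 3. (Restricted strong convexity) There is $\mu>0$ with $x^T\nabla^2f(x^*)x\ge\mu\|x\|^2$ for all $x$ with $Bx=0$. 4. (Nondegeneracy) $-\nabla f(x^*)\in\operatorname{ri}\mathcal N_{\mathcal X}(x^*)$,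 where $\mathcal N_{\mathcal X}(x^*)=\{v:\langle v,y-x^*\rangle\le0\ \forall y\in\mathcal X\}$ and $\operatorname{ri}$ is the relative interior. 5. For every $j$ the samples $\xi_{j,1},\xi_{j,2},\dots$ are i.i.d. copies of $\xi_j$, $\xi_{j,k}$ being drawn independently of $\mathcal F_k$; for $i\ne j$, $\xi_{i,k}$ and $\xi_{j,k}$ are conditionally independent given $\sigma(\mathcal F_k\cup\sigma(A_k))$; and $\xi_{j,k}$ is conditionally independent of $A_k$ given $\mathcal F_k$. 6. $A_1,A_2,\dots$ are i.i.d. and almost surely doubly stochastic (with nonnegative entries), the spectral norm of $\mathbb E[A_k^T(I_m-\frac1m\mathbf 1\mathbf 1^T)A_k]$ is less than $1$, and $A_k$ is independent of $\mathcal F_k$. 7. $\alpha_k=a/k^{\alpha}$ with $a>0$ and $\alpha\in(\frac23,1)$. Differentiability and gradients are understood relative to $\mathcal X$: $g$ is a gradient of $h$ at $x\in\mathcal X$ if $h(y)=h(x)+\langle g,y-x\rangle+o(\|y-x\|)$ as $y\to x$, $y\in\mathcal X$, and likewise $\nabla^2 f(x^*)$ is a derivative of $\nabla f$ at $x^*$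 relative to $\mathcal X$; if $\mathcal X$ has empty interior, $\nabla F_j$, $\nabla f_j$, $\nabla^2f(x^*)$ denote any fixed choice of such gradients and derivative, and $\nabla f=\sum_j\nabla f_j$. Conclusion. Almost surely there is a finite (random) $K$ such that for all $k\ge K$ $$B\bar x_k=b\quad\text{and}\quad C\bar x_k<c .$$ -/

import Mathlib

open MeasureTheory ProbabilityTheory
open scoped RealInnerProductSpace Matrix

namespace DDA

/-- `ℝ^d` with the Euclidean norm. -/
abbrev Vec (d : ℕ) : Type := EuclideanSpace ℝ (Fin d)

/-- Real matrices carry the product (entrywise) σ-algebra. -/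
instance instMeasurableSpaceMatrix (m n : ℕ) : MeasurableSpace (Matrix (Fin m) (Fin n) ℝ) :=
  inferInstanceAs (MeasurableSpace (Fin m → Fin n → ℝ))

/-! ### Constraint set, normal cone, regularizer and mirror map -/

/-- The polyhedron `{x : B x ≤ b, C x ≤ c}`; `≤` is componentwise. -/
def feasibleSet {d d₁ d₂ : ℕ} (B : Matrix (Fin d₁) (Fin d) ℝ) (b : Fin d₁ → ℝ)
    (C : Matrix (Fin d₂) (Fin d) ℝ) (c : Fin d₂ → ℝ) : Set (Vec d) :=
  {x | (∀ i, (B *ᵥ x.ofLp) i ≤ b i) ∧ ∀ i, (C *ᵥ x.ofLp) i ≤ c i}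

/-- The normal cone `{v : ⟨v, y - x⟩ ≤ 0 for all y ∈ X}`. -/
def normalCone {d : ℕ} (X : Set (Vec d)) (x : Vec d) : Set (Vec d) :=
  {v | ∀ y ∈ X, ⟪v, y - x⟫ ≤ 0}

/-- The Euclidean regularizer `ψ(x) = ‖x‖² / 2`. -/
noncomputable def euclideanReg {d : ℕ} (x : Vec d) : ℝ := ‖x‖ ^ 2 / 2

/-- The mirror map `Q(z) = argmax_{x ∈ X} (⟨z, x⟩ - ψ(x))`. The maximizer exists and is unique when
`X` is nonempty, closed and convex and `ψ` is the Euclidean regularizer. -/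
noncomputable def mirrorMap {d : ℕ} (ψ : Vec d → ℝ) (X : Set (Vec d)) (z : Vec d) : Vec d :=
  Classical.epsilon fun x => x ∈ X ∧ IsMaxOn (fun y => ⟪z, y⟫ - ψ y) X x

/-! ### Objective -/

/-- `f_j(x) = 𝔼[F_j(x; ξ_j)]`, where `ν j` is the law of `ξ_j`. -/
noncomputable def localObjective {m d : ℕ} {Ξ : Fin m → Type*} [∀ j, MeasurableSpace (Ξ j)]
    (F : (j : Fin m) → Vec d → Ξ j → ℝ) (ν : (j : Fin m) → Measure (Ξ j))
    (j : Fin m) (x : Vec d) : ℝ :=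
  ∫ s, F j x s ∂(ν j)

/-- `f = ∑_j f_j`. -/
noncomputable def objective {m d : ℕ} {Ξ : Fin m → Type*} [∀ j, MeasurableSpace (Ξ j)]
    (F : (j : Fin m) → Vec d → Ξ j → ℝ) (ν : (j : Fin m) → Measure (Ξ j)) (x : Vec d) : ℝ :=
  ∑ j, localObjective F ν j x

/-- The set of minimizers of `f` over `X`. -/
def optimalSet {d : ℕ} (f : Vec d → ℝ) (X : Set (Vec d)) : Set (Vec d) :=
  {x | x ∈ X ∧ IsMinOn f X x}

/-! ### The algorithm -/

/-- The in-neighbours `{i : [A]_{ji} > 0}` of agent `j`. -/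
noncomputable def neighbors {m : ℕ} (A : Matrix (Fin m) (Fin m) ℝ) (j : Fin m) : Finset (Fin m) :=
  open scoped Classical in Finset.univ.filter fun i => 0 < A j i

/-- The dual variables `z_{j,k}`, `k ≥ 0`, of distributed dual averaging:
`z_{j,k} = ∑_{i ∈ N_{j,k}} [A_k]_{ji} z_{i,k-1} - α_k ∇F_j(x_{j,k}; ξ_{j,k})` with
`x_{j,k} = Q(z_{j,k-1})`. Weights, step sizes and samples are used for times `k ≥ 1` only. -/
noncomputable def dual {m d : ℕ} {Ω : Type*} {Ξ : Fin m → Type*}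
    (X : Set (Vec d)) (ψ : Vec d → ℝ) (gradF : (j : Fin m) → Vec d → Ξ j → Vec d) (α : ℕ → ℝ)
    (z₀ : Fin m → Ω → Vec d) (ξ : (j : Fin m) → ℕ → Ω → Ξ j)
    (A : ℕ → Ω → Matrix (Fin m) (Fin m) ℝ) : ℕ → Fin m → Ω → Vec d
  | 0 => z₀
  | k + 1 => fun j ω =>
      ∑ i ∈ neighbors (A (k + 1) ω) j, A (k + 1) ω j i • dual X ψ gradF α z₀ ξ A k i ω
        - α (k + 1) • gradF j (mirrorMap ψ X (dual X ψ gradF α z₀ ξ A k j ω)) (ξ j (k + 1) ω)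

/-- `z̄_k = (1/m) ∑_j z_{j,k}`. -/
noncomputable def dualAvg {m d : ℕ} {Ω : Type*} {Ξ : Fin m → Type*}
    (X : Set (Vec d)) (ψ : Vec d → ℝ) (gradF : (j : Fin m) → Vec d → Ξ j → Vec d) (α : ℕ → ℝ)
    (z₀ : Fin m → Ω → Vec d) (ξ : (j : Fin m) → ℕ → Ω → Ξ j)
    (A : ℕ → Ω → Matrix (Fin m) (Fin m) ℝ) (k : ℕ) (ω : Ω) : Vec d :=
  (m : ℝ)⁻¹ • ∑ j, dual X ψ gradF α z₀ ξ A k j ω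

/-- `x̄_k = Q(z̄_{k-1})`, meaningful for `k ≥ 1`. -/
noncomputable def primalAvg {m d : ℕ} {Ω : Type*} {Ξ : Fin m → Type*}
    (X : Set (Vec d)) (ψ : Vec d → ℝ) (gradF : (j : Fin m) → Vec d → Ξ j → Vec d) (α : ℕ → ℝ)
    (z₀ : Fin m → Ω → Vec d) (ξ : (j : Fin m) → ℕ → Ω → Ξ j)
    (A : ℕ → Ω → Matrix (Fin m) (Fin m) ℝ) (k : ℕ) (ω : Ω) : Vec d :=
  mirrorMap ψ X (dualAvg X ψ gradF α z₀ ξ A (k - 1) ω)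

/-- The history `𝓕_k = σ(z_{j,0}, ξ_{j,t}, A_t : j ∈ V, 1 ≤ t ≤ k - 1)`. -/
abbrev history {m d : ℕ} {Ω : Type*} {Ξ : Fin m → Type*} [∀ j, MeasurableSpace (Ξ j)]
    (z₀ : Fin m → Ω → Vec d) (ξ : (j : Fin m) → ℕ → Ω → Ξ j)
    (A : ℕ → Ω → Matrix (Fin m) (Fin m) ℝ) (k : ℕ) : MeasurableSpace Ω :=
  (⨆ j, MeasurableSpace.comap (z₀ j) inferInstance) ⊔
    (⨆ j, ⨆ t ∈ Set.Ico 1 k, MeasurableSpace.comap (ξ j t) inferInstance) ⊔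
    (⨆ t ∈ Set.Ico 1 k, MeasurableSpace.comap (A t) inferInstance)

/-! ### Assumptions -/

/-- `X` and `Y` are conditionally independent given the σ-algebra `𝓖`:
`P(X ∈ s, Y ∈ t | 𝓖) = P(X ∈ s | 𝓖) P(Y ∈ t | 𝓖)` almost surely for all measurable `s`, `t`. -/
def CondIndepGiven {Ω β γ : Type*} [MeasurableSpace Ω] [MeasurableSpace β] [MeasurableSpace γ]
    (μ : Measure Ω) (𝓖 : MeasurableSpace Ω) (X : Ω → β) (Y : Ω → γ) : Prop :=
  ∀ s t, MeasurableSet s → MeasurableSet t →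
    (μ⟦X ⁻¹' s ∩ Y ⁻¹' t | 𝓖⟧) =ᵐ[μ] fun ω => (μ⟦X ⁻¹' s | 𝓖⟧) ω * (μ⟦Y ⁻¹' t | 𝓖⟧) ω

/-- The averaging matrix `𝟏𝟏ᵀ/m`. -/
noncomputable def averaging (m : ℕ) : Matrix (Fin m) (Fin m) ℝ := Matrix.of fun _ _ => (m : ℝ)⁻¹

/-- The disagreement matrix `Aᵀ (I - 𝟏𝟏ᵀ/m) A`. -/
noncomputable def disagreement {m : ℕ} (A : Matrix (Fin m) (Fin m) ℝ) :
    Matrix (Fin m) (Fin m) ℝ :=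
  Aᵀ * (1 - averaging m) * A

/-- The spectral norm of `𝔼[Aᵀ (I - 𝟏𝟏ᵀ/m) A]`, the expectation being taken entrywise. -/
noncomputable def mixingNorm {m : ℕ} {Ω : Type*} [MeasurableSpace Ω] (μ : Measure Ω)
    (A : Ω → Matrix (Fin m) (Fin m) ℝ) : ℝ :=
  ‖Matrix.toEuclideanCLM (𝕜 := ℝ) (n := Fin m)
    (Matrix.of fun i j => ∫ ω, disagreement (A ω) i j ∂μ)‖

/-- Standing conditions on the random objectives: `F_j(·; s)` is convex and differentiable on `X`
with gradient `gradF j · s` for every `s`, and Lipschitz on `X` with a measurable constant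
`L_{0,j}(s)` that has a finite `p`-th moment for some `p ≥ 2`. Differentiability and gradients are
relative to `X`, so that nothing is asked of `F_j` outside `X`; the gradient is the usual one
wherever `F_j(·; s)` is differentiable in the ambient space. -/
structure ObjectiveAssumption {m d : ℕ} {Ξ : Fin m → Type*} [∀ j, MeasurableSpace (Ξ j)]
    (X : Set (Vec d)) (F : (j : Fin m) → Vec d → Ξ j → ℝ)
    (gradF : (j : Fin m) → Vec d → Ξ j → Vec d) (ν : (j : Fin m) → Measure (Ξ j)) : Prop where
  integrable : ∀ j, ∀ x ∈ X, Integrable (F j x) (ν j)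
  measurable_grad : ∀ j, Measurable fun q : X × Ξ j => gradF j q.1 q.2
  convex : ∀ j s, ConvexOn ℝ X fun x => F j x s
  hasGradient : ∀ j s, ∀ x ∈ X, HasGradientWithinAt (fun y => F j y s) (gradF j x s) X x
  lipschitz : ∀ j, ∃ (p : ℝ) (L₀ : Ξ j → ℝ), 2 ≤ p ∧ Measurable L₀ ∧
    MemLp L₀ (ENNReal.ofReal p) (ν j) ∧
    ∀ s, ∀ x ∈ X, ∀ y ∈ X, |F j x s - F j y s| ≤ L₀ s * ‖x - y‖

/-- Conditions on the expected objectives: `gradf j` is the gradient of `f_j` on `X` and is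
Lipschitz there; `hess` is the Hessian of `f = ∑_j f_j` at `xstar`, the first-order expansion of
`∇f` at `xstar` has a locally quadratic remainder on `X`, and `hess` is positive definite on
`{x : B x = 0}`. -/
structure RegularityAssumption {m d d₁ : ℕ} {Ξ : Fin m → Type*} [∀ j, MeasurableSpace (Ξ j)]
    (X : Set (Vec d)) (B : Matrix (Fin d₁) (Fin d) ℝ)
    (F : (j : Fin m) → Vec d → Ξ j → ℝ) (ν : (j : Fin m) → Measure (Ξ j))
    (gradf : Fin m → Vec d → Vec d) (hess : Vec d →L[ℝ] Vec d) (xstar : Vec d) : Prop where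
  hasGradient : ∀ j, ∀ x ∈ X, HasGradientWithinAt (localObjective F ν j) (gradf j x) X x
  lipschitz : ∀ j, ∃ L > 0, ∀ x ∈ X, ∀ y ∈ X, ‖gradf j x - gradf j y‖ ≤ L * ‖x - y‖
  hasHessian : HasFDerivWithinAt (fun x => ∑ j, gradf j x) hess X xstar
  expansion : ∃ c₀ > 0, ∃ ε > 0, ∀ x ∈ X, ‖x - xstar‖ ≤ ε →
    ‖(∑ j, gradf j x) - (∑ j, gradf j xstar) - hess (x - xstar)‖ ≤ c₀ * ‖x - xstar‖ ^ 2
  restrictedStrongConvexity : ∃ κ > 0, ∀ x : Vec d, B *ᵥ x.ofLp = 0 → κ * ‖x‖ ^ 2 ≤ ⟪x, hess x⟫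

/-- Conditions on the samples: for each agent they are i.i.d. with law `ν j`, the sample of time `k`
being a fresh draw, independent of the history `𝓕_k`; distinct agents' samples of time `k` are
conditionally independent given `σ(𝓕_k, A_k)`; and each is conditionally independent of `A_k`
given `𝓕_k`. -/
structure SampleAssumption {m d : ℕ} {Ω : Type*} [MeasurableSpace Ω] {Ξ : Fin m → Type*}
    [∀ j, MeasurableSpace (Ξ j)] (μ : Measure Ω) (ν : (j : Fin m) → Measure (Ξ j))
    (z₀ : Fin m → Ω → Vec d) (ξ : (j : Fin m) → ℕ → Ω → Ξ j)
    (A : ℕ → Ω → Matrix (Fin m) (Fin m) ℝ) : Prop where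
  measurable_init : ∀ j, Measurable (z₀ j)
  measurable : ∀ j, ∀ k ≥ 1, Measurable (ξ j k)
  law : ∀ j, ∀ k ≥ 1, μ.map (ξ j k) = ν j
  indep : ∀ j, iIndepFun (fun k => ξ j (k + 1)) μ
  fresh : ∀ j, ∀ k ≥ 1, Indep (MeasurableSpace.comap (ξ j k) inferInstance) (history z₀ ξ A k) μ
  condIndep_agents : ∀ i j, i ≠ j → ∀ k ≥ 1,
    CondIndepGiven μ (history z₀ ξ A k ⊔ MeasurableSpace.comap (A k) inferInstance) (ξ i k) (ξ j k)
  condIndep_weights : ∀ j, ∀ k ≥ 1, CondIndepGiven μ (history z₀ ξ A k) (ξ j k) (A k)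

/-- Conditions on the weights: `A_1, A_2, …` are i.i.d. random doubly stochastic matrices, the
spectral norm of `𝔼[A_kᵀ (I - 𝟏𝟏ᵀ/m) A_k]` is less than `1`, and `A_k` is independent of `𝓕_k`. -/
structure WeightAssumption {m d : ℕ} {Ω : Type*} [MeasurableSpace Ω] {Ξ : Fin m → Type*}
    [∀ j, MeasurableSpace (Ξ j)] (μ : Measure Ω)
    (z₀ : Fin m → Ω → Vec d) (ξ : (j : Fin m) → ℕ → Ω → Ξ j)
    (A : ℕ → Ω → Matrix (Fin m) (Fin m) ℝ) : Prop where
  measurable : ∀ k ≥ 1, Measurable (A k)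
  stochastic : ∀ k ≥ 1, ∀ᵐ ω ∂μ, A k ω ∈ doublyStochastic ℝ (Fin m)
  indep : iIndepFun (fun k => A (k + 1)) μ
  identDistrib : ∀ k ≥ 1, IdentDistrib (A k) (A 1) μ μ
  mixing : ∀ k ≥ 1, mixingNorm μ (A k) < 1
  indep_history : ∀ k ≥ 1,
    Indep (MeasurableSpace.comap (A k) inferInstance) (history z₀ ξ A k) μ

end DDA

open Filter Topology

namespace DDA

/-! ### The mirror map of the Euclidean regularizer -/

section MirrorMap

variable {d : ℕ} {X : Set (Vec d)}

/-! `Q` is the Euclidean projection onto the polyhedron `X`. The averaged dual iterate moves by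
minus a noisy mean gradient, so once `x̄_k → x*` it grows like `(∑ α_t) • v` with `v = -∇f(x*)/m`.
Nondegeneracy makes `v` sharp: leaving the face `Bx = b` costs `⟨v, x - x*⟩` an amount proportional
to the violation. As `∑ α_t = ∞`, this cost eventually beats the bounded part of the variational
inequality defining `Q`, so the projection lands exactly on the face
(`eventually_active_of_tendsto`). The constraints `Cx < c` are open, so convergence alone settles
them.

Convergence (`ae_tendsto_mirrorMap_mean`) uses the Fenchel coupling `R` of the averaged dual iterate
and `x*` as Lyapunov function. Mixing in mean square makes the squared disagreements summable
(`ae_summable_sq_sub_mean`), so the average follows a perturbed stochastic descent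
(`coupling_mean_step_le`). Neither `X` nor `R` is bounded in advance, so the descent is run for `log
(1 + R)`: the noise is then tested against a vector of norm at most 1 and its sum converges as an
`L²`-bounded martingale. Non-summable steps and uniqueness of the minimizer (`eq_of_isMinOn`) force
the limit of `R` to be zero, because on a polyhedron `R` equals half the squared distance near `x*`
(`eventually_coupling_eq`).

Gradients relative to `X` are determined only along the direction space of `X`. All dual quantities
are therefore projected onto that space. `Q` does not notice (`mirrorMap_starProjection`), while the
projected gradients are square integrable, dominated by a multiple of the Lipschitz constants, and
have the right mean (`exists_norm_starProjection_grad_le`, `integral_starProjection_grad`). -/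

lemma isMaxOn_euclideanReg_of_inner_le {z x : Vec d} (h : ∀ y ∈ X, ⟪z - x, y - x⟫ ≤ 0) :
    IsMaxOn (fun y => ⟪z, y⟫ - euclideanReg y) X x := by
  intro y hy
  have h1 := h y hy
  have h2 : 0 ≤ ‖y - x‖ ^ 2 := sq_nonneg _
  simp only [Set.mem_ofPred_eq, euclideanReg]
  rw [← real_inner_self_eq_norm_sq] at h2 ⊢
  rw [← real_inner_self_eq_norm_sq]
  simp only [inner_sub_left, inner_sub_right] at h1 h2
  rw [real_inner_comm x y] at h2
  rw [real_inner_comm y x] at h1 h2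
  linarith

lemma inner_le_of_isMaxOn_euclideanReg (hX : Convex ℝ X) {z x : Vec d} (hx : x ∈ X)
    (h : IsMaxOn (fun y => ⟪z, y⟫ - euclideanReg y) X x) {y : Vec d} (hy : y ∈ X) :
    ⟪z - x, y - x⟫ ≤ 0 := by
  by_contra! hpos
  -- Optimality against `x + t • (y - x)`, divided by `t`; the quadratic remainder disappears as `t
  -- → 0`.
  have key : ∀ t : ℝ, 0 < t → t ≤ 1 → ⟪z - x, y - x⟫ ≤ t / 2 * ‖y - x‖ ^ 2 := by
    intro t ht ht1
    have hmem : x + t • (y - x) ∈ X := hX.add_smul_sub_mem hx hy ⟨ht.le, ht1⟩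
    have h1 := h hmem
    simp only [Set.mem_ofPred_eq, euclideanReg] at h1
    rw [norm_add_sq_real, inner_add_right, inner_smul_right, inner_smul_right, norm_smul,
      Real.norm_of_nonneg ht.le] at h1
    rw [inner_sub_left]
    have : t * (⟪z, y - x⟫ - ⟪x, y - x⟫) ≤ t * (t / 2 * ‖y - x‖ ^ 2) := by nlinarith
    exact le_of_mul_le_mul_left this ht
  have hlim : Tendsto (fun t : ℝ => t / 2 * ‖y - x‖ ^ 2) (𝓝[>] 0) (𝓝 0) := by
    have : Tendsto (fun t : ℝ => t / 2 * ‖y - x‖ ^ 2) (𝓝 0) (𝓝 (0 / 2 * ‖y - x‖ ^ 2)) :=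
      Continuous.tendsto (by fun_prop) 0
    simpa using this.mono_left nhdsWithin_le_nhds
  have := ge_of_tendsto hlim (by
    filter_upwards [Ioc_mem_nhdsGT (zero_lt_one (α := ℝ))] with t ht
    exact key t ht.1 ht.2)
  linarith

lemma mirrorMap_spec (hne : X.Nonempty) (hcl : IsClosed X) (hX : Convex ℝ X)
    (z : Vec d) :
    mirrorMap euclideanReg X z ∈ X ∧
      IsMaxOn (fun y => ⟪z, y⟫ - euclideanReg y) X (mirrorMap euclideanReg X z) := by
  obtain ⟨x, hx, hmin⟩ := exists_norm_eq_iInf_of_complete_convex hne hcl.isComplete hX z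
  have := (norm_eq_iInf_iff_real_inner_le_zero hX hx).1 hmin
  exact Classical.epsilon_spec
    (p := fun x => x ∈ X ∧ IsMaxOn (fun y => ⟪z, y⟫ - euclideanReg y) X x)
    ⟨x, hx, isMaxOn_euclideanReg_of_inner_le this⟩

lemma mirrorMap_mem (hne : X.Nonempty) (hcl : IsClosed X) (hX : Convex ℝ X)
    (z : Vec d) : mirrorMap euclideanReg X z ∈ X :=
  (mirrorMap_spec hne hcl hX z).1

lemma inner_mirrorMap_le (hne : X.Nonempty) (hcl : IsClosed X) (hX : Convex ℝ X)
    (z : Vec d) {y : Vec d} (hy : y ∈ X) :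
    ⟪z - mirrorMap euclideanReg X z, y - mirrorMap euclideanReg X z⟫ ≤ 0 :=
  inner_le_of_isMaxOn_euclideanReg hX (mirrorMap_spec hne hcl hX z).1
    (mirrorMap_spec hne hcl hX z).2 hy

/-- Stability of the projection onto `X`: only the part of `z - w` seen by `X` matters. -/
lemma norm_sub_le_of_inner_le {z w x y e : Vec d} (hx : x ∈ X) (hy : y ∈ X)
    (he : ∀ u ∈ X, ∀ v ∈ X, ⟪z - w, u - v⟫ = ⟪e, u - v⟫)
    (hzx : ∀ u ∈ X, ⟪z - x, u - x⟫ ≤ 0) (hwy : ∀ u ∈ X, ⟪w - y, u - y⟫ ≤ 0) :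
    ‖x - y‖ ≤ ‖e‖ := by
  have h1 := hzx y hy
  have h2 := hwy x hx
  have h3 : ‖x - y‖ ^ 2 ≤ ⟪e, x - y⟫ := by
    rw [← he x hx y hy, ← real_inner_self_eq_norm_sq]
    simp only [inner_sub_left, inner_sub_right] at h1 h2 ⊢
    rw [real_inner_comm x y] at *
    linarith
  have h4 := real_inner_le_norm e (x - y)
  by_contra! h
  nlinarith [norm_nonneg e, norm_nonneg (x - y)]

lemma norm_mirrorMap_sub_le (hne : X.Nonempty) (hcl : IsClosed X) (hX : Convex ℝ X)
    (z w : Vec d) :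
    ‖mirrorMap euclideanReg X z - mirrorMap euclideanReg X w‖ ≤ ‖z - w‖ :=
  norm_sub_le_of_inner_le (mirrorMap_mem hne hcl hX z) (mirrorMap_mem hne hcl hX w)
    (fun _ _ _ _ => rfl) (fun _ hu => inner_mirrorMap_le hne hcl hX z hu)
    (fun _ hu => inner_mirrorMap_le hne hcl hX w hu)

lemma continuous_mirrorMap (hne : X.Nonempty) (hcl : IsClosed X) (hX : Convex ℝ X) :
    Continuous (mirrorMap euclideanReg X) := by
  refine LipschitzWith.continuous (K := 1) (LipschitzWith.of_dist_le_mul fun z w => ?_)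
  simpa [dist_eq_norm] using norm_mirrorMap_sub_le hne hcl hX z w

lemma inner_starProjection_vectorSpan {x y : Vec d} (hx : x ∈ X) (hy : y ∈ X) (z : Vec d) :
    ⟪(vectorSpan ℝ X).starProjection z, x - y⟫ = ⟪z, x - y⟫ := by
  have := (vectorSpan ℝ X).starProjection_inner_eq_zero z (x - y)
    (vsub_mem_vectorSpan ℝ hx hy)
  rw [inner_sub_left] at this
  linarith

/-- A dual component orthogonal to all differences of points of `X` cannot influence the maximizer.
This permits running the analysis on projected dual variables. -/
lemma mirrorMap_starProjection (hne : X.Nonempty) (hcl : IsClosed X) (hX : Convex ℝ X)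
    (z : Vec d) :
    mirrorMap euclideanReg X ((vectorSpan ℝ X).starProjection z) = mirrorMap euclideanReg X z := by
  have := norm_sub_le_of_inner_le (e := 0) (mirrorMap_mem hne hcl hX
    ((vectorSpan ℝ X).starProjection z)) (mirrorMap_mem hne hcl hX z)
    (fun u hu v hv => by
      rw [inner_sub_left, inner_starProjection_vectorSpan hu hv, sub_self, inner_zero_left])
    (fun _ hu => inner_mirrorMap_le hne hcl hX _ hu)
    (fun _ hu => inner_mirrorMap_le hne hcl hX z hu)
  rw [norm_zero, norm_le_zero_iff, sub_eq_zero] at this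
  exact this

/-! ### The Fenchel coupling -/

/-- The Fenchel coupling `ψ*(y) - ⟨y, p⟩ + ψ(p)` of a dual point `y` and a primal point `p`. -/
noncomputable def coupling (X : Set (Vec d)) (p y : Vec d) : ℝ :=
  -- Obtained by inserting `ψ*(y) = ⟨y, Q(y)⟩ - ‖Q(y)‖² / 2`; in this form the first term is
  -- nonnegative for `p ∈ X`.
  ⟪y - mirrorMap euclideanReg X y, mirrorMap euclideanReg X y - p⟫
    + ‖mirrorMap euclideanReg X y - p‖ ^ 2 / 2

lemma half_norm_sq_le_coupling (hne : X.Nonempty) (hcl : IsClosed X) (hX : Convex ℝ X)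
    {p : Vec d} (hp : p ∈ X) (y : Vec d) :
    ‖mirrorMap euclideanReg X y - p‖ ^ 2 / 2 ≤ coupling X p y := by
  have := inner_mirrorMap_le hne hcl hX y hp
  rw [← neg_sub _ p, inner_neg_right] at this
  unfold coupling
  linarith

lemma coupling_nonneg (hne : X.Nonempty) (hcl : IsClosed X) (hX : Convex ℝ X)
    {p : Vec d} (hp : p ∈ X) (y : Vec d) : 0 ≤ coupling X p y :=
  le_trans (by positivity) (half_norm_sq_le_coupling hne hcl hX hp y)

/-- Smoothness of `ψ*`, whose gradient `Q` is nonexpansive. Concretely: add the variational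
inequality at `y`, tested at the new projection `x'`, to `‖h - (x' - x)‖² ≥ 0`. -/
lemma coupling_add_le (hne : X.Nonempty) (hcl : IsClosed X) (hX : Convex ℝ X)
    (p y h : Vec d) :
    coupling X p (y + h) ≤
      coupling X p y + ⟪h, mirrorMap euclideanReg X y - p⟫ + ‖h‖ ^ 2 / 2 := by
  set x := mirrorMap euclideanReg X y with hx
  set x' := mirrorMap euclideanReg X (y + h) with hx'
  have h1 : ⟪y - x, x' - x⟫ ≤ 0 := inner_mirrorMap_le hne hcl hX y (mirrorMap_mem hne hcl hX _)
  have h2 : 0 ≤ ‖h - (x' - x)‖ ^ 2 := sq_nonneg _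
  unfold coupling
  rw [← hx, ← hx']
  simp only [← real_inner_self_eq_norm_sq] at h2 ⊢
  simp only [inner_sub_left, inner_sub_right, inner_add_left] at h1 h2 ⊢
  rw [real_inner_comm x' h, real_inner_comm x h, real_inner_comm x' x] at *
  rw [real_inner_comm p x, real_inner_comm p x'] at *
  linarith

lemma continuous_coupling (hne : X.Nonempty) (hcl : IsClosed X) (hX : Convex ℝ X)
    (p : Vec d) : Continuous (coupling X p) := by
  have := continuous_mirrorMap hne hcl hX
  unfold coupling
  fun_prop

end MirrorMap

/-! ### Norm bounds from finitely many directions -/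

section Span

variable {E : Type*} [NormedAddCommGroup E] [InnerProductSpace ℝ E]

/-- The point is that `K` does not depend on `g`. The weight `β` is later `‖w‖` for feasible
directions and `1` for the rows of `B`. -/
lemma exists_abs_inner_le_of_mem_span {S : Set E} (β : E → ℝ) {v : E}
    (hv : v ∈ Submodule.span ℝ S) :
    ∃ K : ℝ, 0 ≤ K ∧ ∀ (g : E) (L : ℝ), 0 ≤ L → (∀ w ∈ S, |⟪g, w⟫| ≤ L * β w) →
      |⟪g, v⟫| ≤ K * L := by
  induction hv using Submodule.span_induction with
  | mem x hx =>
    refine ⟨|β x|, abs_nonneg _, fun g L hL h => (h x hx).trans ?_⟩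
    rw [mul_comm]
    exact mul_le_mul_of_nonneg_right (le_abs_self _) hL
  | zero => exact ⟨0, le_rfl, fun g L hL h => by simp⟩
  | add x y _ _ hx hy =>
    obtain ⟨K₁, h1, h1'⟩ := hx
    obtain ⟨K₂, h2, h2'⟩ := hy
    refine ⟨K₁ + K₂, by positivity, fun g L hL h => ?_⟩
    rw [inner_add_right, add_mul]
    exact (abs_add_le _ _).trans (add_le_add (h1' g L hL h) (h2' g L hL h))
  | smul a x _ hx =>
    obtain ⟨K₁, h1, h1'⟩ := hx
    refine ⟨|a| * K₁, by positivity, fun g L hL h => ?_⟩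
    rw [inner_smul_right, abs_mul, mul_assoc]
    exact mul_le_mul_of_nonneg_left (h1' g L hL h) (abs_nonneg _)

/-- The projection onto a span is controlled by the inner products with the spanning vectors. -/
lemma exists_norm_starProjection_span_le [FiniteDimensional ℝ E] (S : Set E) (β : E → ℝ) :
    ∃ K : ℝ, 0 ≤ K ∧ ∀ (g : E) (L : ℝ), 0 ≤ L → (∀ w ∈ S, |⟪g, w⟫| ≤ L * β w) →
      ‖(Submodule.span ℝ S).starProjection g‖ ≤ K * L := by
  set U := Submodule.span ℝ S with hU
  let e := stdOrthonormalBasis ℝ U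
  choose K hK0 hK using fun i => exists_abs_inner_le_of_mem_span β (e i).2
  refine ⟨∑ i, K i, Finset.sum_nonneg fun i _ => hK0 i, fun g L hL h => ?_⟩
  have hsum : U.starProjection g = ∑ i, ⟪g, (e i : E)⟫ • (e i : E) := by
    have := e.sum_repr' (U.orthogonalProjectionOnto g)
    rw [Submodule.starProjection_apply, ← this]
    push_cast
    refine Finset.sum_congr rfl fun i _ => ?_
    rw [Submodule.coe_inner, ← Submodule.starProjection_apply,
      ← Submodule.inner_starProjection_left_eq_right,
      Submodule.starProjection_mem_subspace_eq_self, real_inner_comm]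
  rw [hsum, Finset.sum_mul]
  refine (norm_sum_le _ _).trans (Finset.sum_le_sum fun i _ => ?_)
  rw [norm_smul, Real.norm_eq_abs]
  have he : ‖(e i : E)‖ = 1 := by
    rw [Submodule.norm_coe]; exact e.norm_eq_one i
  rw [he, mul_one]
  exact hK i g L hL h

end Span

/-! ### Polyhedra -/

section Polyhedron

variable {ι E : Type*} [NormedAddCommGroup E] [InnerProductSpace ℝ E]

/-- The polyhedron `{x : ⟨r i, x⟩ ≤ q i for all i}`. -/
def polyhedron (r : ι → E) (q : ι → ℝ) : Set E := {x | ∀ i, ⟪r i, x⟫ ≤ q i}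

lemma convex_polyhedron (r : ι → E) (q : ι → ℝ) : Convex ℝ (polyhedron r q) := by
  intro x hx y hy s t hs ht hst i
  rw [inner_add_right, inner_smul_right, inner_smul_right]
  calc s * ⟪r i, x⟫ + t * ⟪r i, y⟫ ≤ s * q i + t * q i :=
        add_le_add (mul_le_mul_of_nonneg_left (hx i) hs) (mul_le_mul_of_nonneg_left (hy i) ht)
    _ = q i := by rw [← add_mul, hst, one_mul]

lemma isClosed_polyhedron (r : ι → E) (q : ι → ℝ) : IsClosed (polyhedron r q) := by
  have : polyhedron r q = ⋂ i, {x | ⟪r i, x⟫ ≤ q i} := by ext x; simp [polyhedron]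
  rw [this]
  exact isClosed_iInter fun i => isClosed_le (by fun_prop) continuous_const

/-- Slack constraints survive a small move by continuity, so only the tight ones restrict the
direction. -/
lemma eventually_add_smul_mem_polyhedron [Finite ι] {r : ι → E} {q : ι → ℝ} {x w : E}
    (hx : x ∈ polyhedron r q) (hw : ∀ i, ⟪r i, x⟫ = q i → ⟪r i, w⟫ ≤ 0) :
    ∀ᶠ t : ℝ in 𝓝[>] 0, x + t • w ∈ polyhedron r q := by
  have : ∀ i, ∀ᶠ t : ℝ in 𝓝[>] 0, ⟪r i, x + t • w⟫ ≤ q i := by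
    intro i
    rcases (hx i).lt_or_eq with h | h
    · have hc : Tendsto (fun t : ℝ => ⟪r i, x + t • w⟫) (𝓝 0) (𝓝 ⟪r i, x + (0 : ℝ) • w⟫) :=
        Continuous.tendsto (by fun_prop) 0
      rw [zero_smul, add_zero] at hc
      exact ((hc.mono_left nhdsWithin_le_nhds).eventually_lt_const h).mono fun _ h => h.le
    · filter_upwards [self_mem_nhdsWithin] with t ht
      rw [inner_add_right, inner_smul_right, h]
      have := mul_nonpos_of_nonneg_of_nonpos (le_of_lt (Set.mem_Ioi.1 ht)) (hw i h)
      linarith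
  exact eventually_all.2 this

/-- Near `p`, a polyhedron contains a prolongation of the segment from `p` to any of its points. -/
lemma eventually_prolong_mem_polyhedron [Finite ι] {r : ι → E} {q : ι → ℝ} {p : E}
    (hp : p ∈ polyhedron r q) :
    ∀ᶠ x in 𝓝[polyhedron r q] p, ∀ᶠ t : ℝ in 𝓝[>] 0, x + t • (x - p) ∈ polyhedron r q := by
  have h : ∀ i, ∀ᶠ x in 𝓝 p, ⟪r i, p⟫ < q i → ⟪r i, x⟫ < q i := by
    intro i
    by_cases hi : ⟪r i, p⟫ < q i
    · have hc : Tendsto (fun x => ⟪r i, x⟫) (𝓝 p) (𝓝 ⟪r i, p⟫) :=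
        Continuous.tendsto (by fun_prop) p
      exact (hc.eventually_lt_const hi).mono fun _ h _ => h
    · exact Eventually.of_forall fun _ h => absurd h hi
  filter_upwards [self_mem_nhdsWithin, nhdsWithin_le_nhds (eventually_all.2 h)] with x hx hx'
  -- A constraint tight at `x` must be tight at `p`, since those slack at `p` stay slack nearby; so
  -- `x - p` is tangent to it.
  refine eventually_add_smul_mem_polyhedron hx fun i hi => ?_
  rcases (hp i).lt_or_eq with h | h
  · exact absurd hi (hx' i h).ne
  · rw [inner_sub_right, hi, h, sub_self]

/-- A vector whose inner products with the feasible directions at a point of a polyhedron are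
controlled is itself controlled modulo the orthogonal complement of the polyhedron's direction,
uniformly in the point. -/
lemma exists_norm_starProjection_vectorSpan_le [Finite ι] [FiniteDimensional ℝ E] (r : ι → E)
    (q : ι → ℝ) :
    ∃ K : ℝ, 0 ≤ K ∧ ∀ x ∈ polyhedron r q, ∀ (g : E) (L : ℝ), 0 ≤ L →
      (∀ w, (∀ᶠ t : ℝ in 𝓝[>] 0, x + t • w ∈ polyhedron r q) → |⟪g, w⟫| ≤ L * ‖w‖) →
      ‖(vectorSpan ℝ (polyhedron r q)).starProjection g‖ ≤ K * L := by
  -- The feasible directions at `x` depend only on the set `I` of tight constraints. For each `I`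
  -- one reference point `x₀` is fixed: the differences `y - x₀` are feasible directions at every
  -- `x` with the same `I`, and they span the direction space. Finitely many `I` give a uniform
  -- constant.
  have key : ∀ I : Set ι, ∃ K : ℝ, 0 ≤ K ∧ ∀ x ∈ polyhedron r q, {i | ⟪r i, x⟫ = q i} = I →
      ∀ (g : E) (L : ℝ), 0 ≤ L →
      (∀ w, (∀ᶠ t : ℝ in 𝓝[>] 0, x + t • w ∈ polyhedron r q) → |⟪g, w⟫| ≤ L * ‖w‖) →
      ‖(vectorSpan ℝ (polyhedron r q)).starProjection g‖ ≤ K * L := by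
    intro I
    by_cases hI : ∃ x₀ ∈ polyhedron r q, {i | ⟪r i, x₀⟫ = q i} = I
    · obtain ⟨x₀, hx₀, hx₀I⟩ := hI
      obtain ⟨K, hK0, hK⟩ :=
        exists_norm_starProjection_span_le ((· -ᵥ x₀) '' polyhedron r q) (fun w : E => ‖w‖)
      refine ⟨K, hK0, fun x hx hxI g L hL h => ?_⟩
      rw [vectorSpan_eq_span_vsub_set_right ℝ hx₀]
      refine hK g L hL ?_
      rintro _ ⟨y, hy, rfl⟩
      refine h _ (eventually_add_smul_mem_polyhedron hx fun i hi => ?_)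
      have hi' : ⟪r i, x₀⟫ = q i := by
        have : i ∈ {i | ⟪r i, x₀⟫ = q i} := by rw [hx₀I, ← hxI]; exact hi
        exact this
      simp only [vsub_eq_sub, inner_sub_right, hi']
      linarith [hy i]
    · exact ⟨0, le_rfl, fun x hx hxI => absurd ⟨x, hx, hxI⟩ hI⟩
  choose K hK0 hK using key
  obtain ⟨M, hM⟩ := (Set.finite_range K).bddAbove
  refine ⟨M, (hK0 ∅).trans (hM ⟨∅, rfl⟩), fun x hx g L hL h => ?_⟩
  exact (hK _ x hx rfl g L hL h).trans (mul_le_mul_of_nonneg_right (hM ⟨_, rfl⟩) hL)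

end Polyhedron

/-! ### The feasible set -/

section Feasible

variable {d d₁ d₂ : ℕ} {B : Matrix (Fin d₁) (Fin d) ℝ} {b : Fin d₁ → ℝ}
  {C : Matrix (Fin d₂) (Fin d) ℝ} {c : Fin d₂ → ℝ}

/-- The `i`-th row of a matrix as a Euclidean vector. -/
noncomputable def rowVec {n : ℕ} (B : Matrix (Fin n) (Fin d) ℝ) (i : Fin n) : Vec d :=
  WithLp.toLp 2 (B i)

lemma inner_rowVec {n : ℕ} (B : Matrix (Fin n) (Fin d) ℝ) (i : Fin n) (x : Vec d) :
    ⟪rowVec B i, x⟫ = (B *ᵥ x.ofLp) i := by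
  simp [rowVec, PiLp.inner_apply, Matrix.mulVec, dotProduct, mul_comm]

lemma feasibleSet_eq_polyhedron :
    feasibleSet B b C c = polyhedron (Sum.elim (rowVec B) (rowVec C)) (Sum.elim b c) := by
  ext x
  simp [feasibleSet, polyhedron, inner_rowVec]

lemma convex_feasibleSet : Convex ℝ (feasibleSet B b C c) := by
  rw [feasibleSet_eq_polyhedron]; exact convex_polyhedron _ _

lemma isClosed_feasibleSet : IsClosed (feasibleSet B b C c) := by
  rw [feasibleSet_eq_polyhedron]; exact isClosed_polyhedron _ _

/-- Near `p` the Fenchel coupling is half the squared distance. -/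
lemma eventually_coupling_eq {p : Vec d} (hp : p ∈ feasibleSet B b C c) :
    ∃ η > 0, ∀ y : Vec d, ‖mirrorMap euclideanReg (feasibleSet B b C c) y - p‖ < η →
      coupling (feasibleSet B b C c) p y =
        ‖mirrorMap euclideanReg (feasibleSet B b C c) y - p‖ ^ 2 / 2 := by
  set X := feasibleSet B b C c with hX
  have hne : X.Nonempty := ⟨p, hp⟩
  have h : ∀ᶠ x in 𝓝[X] p, ∀ᶠ t : ℝ in 𝓝[>] 0, x + t • (x - p) ∈ X := by
    rw [hX, feasibleSet_eq_polyhedron] at hp ⊢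
    exact eventually_prolong_mem_polyhedron hp
  obtain ⟨η, hη, hball⟩ := Metric.mem_nhdsWithin_iff.1 h
  refine ⟨η, hη, fun y hy => ?_⟩
  set x := mirrorMap euclideanReg X y with hx
  have hxX : x ∈ X := mirrorMap_mem hne isClosed_feasibleSet convex_feasibleSet y
  have hx' : ∀ᶠ t : ℝ in 𝓝[>] 0, x + t • (x - p) ∈ X :=
    hball ⟨by rwa [Metric.mem_ball, dist_eq_norm], hxX⟩
  -- Both `p` and a point beyond `x` on the ray from `p` lie in `X`; the variational inequality at
  -- these two points gives `⟨y - x, x - p⟩ = 0`.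
  obtain ⟨t, ht, ht0⟩ := (hx'.and self_mem_nhdsWithin).exists
  have h1 := inner_mirrorMap_le hne isClosed_feasibleSet convex_feasibleSet y ht
  rw [← hx, add_sub_cancel_left, inner_smul_right] at h1
  have h2 := inner_mirrorMap_le hne isClosed_feasibleSet convex_feasibleSet y hp
  rw [← hx, ← neg_sub x p, inner_neg_right] at h2
  have h3 : ⟪y - x, x - p⟫ ≤ 0 := nonpos_of_mul_nonpos_right h1 ht0
  unfold coupling
  rw [← hx]
  linarith

lemma rowVec_mem_normalCone {p : Vec d} (hp : B *ᵥ p.ofLp = b) (l : Fin d₁) :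
    rowVec B l ∈ normalCone (feasibleSet B b C c) p := by
  intro y hy
  rw [inner_sub_right, inner_rowVec, inner_rowVec, hp]
  linarith [hy.1 l]

/-- A relative interior point of the normal cone strictly penalizes leaving the active face. -/
lemma exists_sharp_of_mem_intrinsicInterior {p v : Vec d} (hp : B *ᵥ p.ofLp = b)
    (hv : v ∈ intrinsicInterior ℝ (normalCone (feasibleSet B b C c) p)) :
    ∃ δ > 0, ∀ x ∈ feasibleSet B b C c,
      δ * ∑ l, |⟪rowVec B l, x - p⟫| ≤ -⟪v, x - p⟫ := by
  set N := normalCone (feasibleSet B b C c) p with hN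
  have hvN : v ∈ N := intrinsicInterior_subset hv
  have h0 : (0 : Vec d) ∈ N := fun y _ => by simp
  obtain ⟨y, hy, hyv⟩ := mem_intrinsicInterior.1 hv
  -- Since `0`, the row and `v` lie in the cone, the line through `v` along the row stays in its
  -- affine span. Relative interiority then allows a small step in the direction opposite to the
  -- row, and membership of `v - t • rowVec B l` in the cone is the sharpness bound for that row.
  have hmem : ∀ l, ∀ t : ℝ, v - t • rowVec B l ∈ affineSpan ℝ N := by
    intro l t
    have := (affineSpan ℝ N).smul_vsub_vadd_mem t (mem_affineSpan ℝ h0)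
      (mem_affineSpan ℝ (rowVec_mem_normalCone (c := c) (C := C) hp l)) (mem_affineSpan ℝ hvN)
    simpa [sub_eq_neg_add] using this
  have hev : ∀ l, ∀ᶠ t : ℝ in 𝓝[>] 0, v - t • rowVec B l ∈ N := by
    intro l
    have hc : Continuous fun t : ℝ => (⟨v - t • rowVec B l, hmem l t⟩ : affineSpan ℝ N) := by
      fun_prop
    have h0' : (⟨v - (0 : ℝ) • rowVec B l, hmem l 0⟩ : affineSpan ℝ N) = y := by
      ext1; simp [hyv]
    have := hc.tendsto 0
    rw [h0'] at this
    exact (this.mono_left nhdsWithin_le_nhds).eventually (mem_interior_iff_mem_nhds.1 hy)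
  obtain ⟨t, ht, ht0⟩ := ((eventually_all.2 hev).and self_mem_nhdsWithin).exists
  replace ht0 : 0 < t := ht0
  -- Summing the row bounds costs a factor `d₁`; the added `1` covers `d₁ = 0`.
  refine ⟨t / (d₁ + 1), by positivity, fun x hx => ?_⟩
  have hvx := hvN x hx
  have hl : ∀ l, t * |⟪rowVec B l, x - p⟫| ≤ -⟪v, x - p⟫ := by
    intro l
    have h1 := ht l x hx
    rw [inner_sub_left, inner_smul_left] at h1
    have h2 := rowVec_mem_normalCone (c := c) (C := C) hp l x hx
    rw [abs_of_nonpos h2]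
    simp at h1
    linarith
  have hsum : t * ∑ l, |⟪rowVec B l, x - p⟫| ≤ d₁ * -⟪v, x - p⟫ := by
    rw [Finset.mul_sum]
    refine (Finset.sum_le_sum fun l _ => hl l).trans ?_
    simp
  rw [div_mul_eq_mul_div, div_le_iff₀ (by positivity)]
  linarith

/-- Feasibility of small moves in the kernel of the active constraints. -/
lemma eventually_add_smul_mem_feasibleSet {p u : Vec d} (hp : B *ᵥ p.ofLp = b)
    (hc : ∀ i, (C *ᵥ p.ofLp) i < c i) (hu : ∀ l, ⟪rowVec B l, u⟫ = 0) :
    ∀ᶠ t : ℝ in 𝓝[>] 0, p + t • u ∈ feasibleSet B b C c := by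
  rw [feasibleSet_eq_polyhedron]
  refine eventually_add_smul_mem_polyhedron ?_ ?_
  · rw [← feasibleSet_eq_polyhedron]
    exact ⟨fun i => (congrFun hp i).le, fun i => (hc i).le⟩
  · rintro (i | i) hi
    · exact (hu i).le
    · simp only [Sum.elim_inr, inner_rowVec] at hi
      exact absurd hi (hc i).ne

/-- Since `C` is slack at `p`, both `u` and `-u` are feasible directions, and a normal vector is
nonpositive on each. -/
lemma inner_eq_zero_of_sharp {p u v : Vec d} (hp : B *ᵥ p.ofLp = b)
    (hc : ∀ i, (C *ᵥ p.ofLp) i < c i)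
    (hv : ∀ x ∈ feasibleSet B b C c, ⟪v, x - p⟫ ≤ 0) (hu : ∀ l, ⟪rowVec B l, u⟫ = 0) :
    ⟪v, u⟫ = 0 := by
  have key : ∀ w : Vec d, (∀ l, ⟪rowVec B l, w⟫ = 0) → ⟪v, w⟫ ≤ 0 := by
    intro w hw
    obtain ⟨t, ht, ht0⟩ :=
      ((eventually_add_smul_mem_feasibleSet hp hc hw).and self_mem_nhdsWithin).exists
    have := hv _ ht
    rw [add_sub_cancel_left, inner_smul_right] at this
    exact nonpos_of_mul_nonpos_right this ht0
  have h1 := key u hu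
  have h2 := key (-u) fun l => by rw [inner_neg_right, hu l, neg_zero]
  rw [inner_neg_right] at h2
  linarith

/-- Finite identification of the active constraints: if `Q(z_k) → p` while the direction of `z_k`
settles at a point that strictly penalizes leaving the active face and `‖z_k‖ → ∞`, then eventually
`Q(z_k)` lies on that face. -/
lemma eventually_active_of_tendsto {p v : Vec d} (hp : B *ᵥ p.ofLp = b)
    (hc : ∀ i, (C *ᵥ p.ofLp) i < c i) {δ : ℝ} (hδ : 0 < δ)
    (hsharp : ∀ x ∈ feasibleSet B b C c, δ * ∑ l, |⟪rowVec B l, x - p⟫| ≤ -⟪v, x - p⟫)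
    {z : ℕ → Vec d} {s : ℕ → ℝ} (hs : Tendsto s atTop atTop)
    (hz : Tendsto (fun k => (s k)⁻¹ • z k) atTop (𝓝 v))
    (hx : Tendsto (fun k => mirrorMap euclideanReg (feasibleSet B b C c) (z k)) atTop (𝓝 p)) :
    ∀ᶠ k in atTop,
      B *ᵥ (mirrorMap euclideanReg (feasibleSet B b C c) (z k)).ofLp = b ∧
      ∀ i, (C *ᵥ (mirrorMap euclideanReg (feasibleSet B b C c) (z k)).ofLp) i < c i := by
  set X := feasibleSet B b C c with hX
  have hpX : p ∈ X := ⟨fun i => (congrFun hp i).le, fun i => (hc i).le⟩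
  have hne : X.Nonempty := ⟨p, hpX⟩
  set x : ℕ → Vec d := fun k => mirrorMap euclideanReg X (z k) with hxdef
  set U := Submodule.span ℝ (Set.range (rowVec B)) with hU
  obtain ⟨K, hK0, hK⟩ := exists_norm_starProjection_span_le (Set.range (rowVec B)) fun _ => 1
  -- `w k` is the component of `x k - p` that leaves the face. The competitor in the variational
  -- inequality is `x k - w k`, which lies on the face and, close to `p`, is feasible.
  set w : ℕ → Vec d := fun k => U.starProjection (x k - p) with hw
  have hwlim : Tendsto w atTop (𝓝 0) := by
    have h1 : Tendsto (fun k => x k - p) atTop (𝓝 0) := by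
      simpa using hx.sub_const p
    have := (U.starProjection.continuous.tendsto 0).comp h1
    rwa [map_zero] at this
  have hwB : ∀ k l, ⟪rowVec B l, x k - w k - p⟫ = 0 := by
    intro k l
    have := U.starProjection_inner_eq_zero (x k - p) (rowVec B l) (Submodule.subset_span ⟨l, rfl⟩)
    rw [real_inner_comm, sub_right_comm]
    exact this
  have hCev : ∀ y : ℕ → Vec d, Tendsto y atTop (𝓝 p) →
      ∀ᶠ k in atTop, ∀ i, (C *ᵥ (y k).ofLp) i < c i := by
    intro y hy
    refine eventually_all.2 fun i => ?_
    have h1 : Tendsto (fun k => ⟪rowVec C i, y k⟫) atTop (𝓝 ⟪rowVec C i, p⟫) :=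
      tendsto_const_nhds.inner hy
    simp only [inner_rowVec] at h1
    exact h1.eventually_lt_const (hc i)
  have hx'lim : Tendsto (fun k => x k - w k) atTop (𝓝 p) := by
    simpa using hx.sub hwlim
  have herr : Tendsto (fun k => ‖(s k)⁻¹ • z k - v‖ + (s k)⁻¹ * ‖x k‖) atTop (𝓝 0) := by
    have h1 : Tendsto (fun k => ‖(s k)⁻¹ • z k - v‖) atTop (𝓝 0) := by
      simpa using (hz.sub_const v).norm
    have h2 := hs.inv_tendsto_atTop.mul hx.norm
    simpa using h1.add h2
  -- `δ / (K + 1)` is the sharpness constant measured against `‖w k‖`: the row products control `‖w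
  -- k‖` up to `K`, and the added `1` keeps the denominator positive.
  have hsmall := herr.eventually_lt_const (show 0 < δ / (K + 1) by positivity)
  filter_upwards [hCev x hx, hCev _ hx'lim, hsmall, hs.eventually_gt_atTop 0] with k h1 h2 h3 h4
  refine ⟨?_, h1⟩
  have hx'B : ∀ l, (B *ᵥ (x k - w k).ofLp) l = b l := by
    intro l
    have := hwB k l
    rw [inner_sub_right, inner_rowVec, inner_rowVec, hp] at this
    linarith
  have hx'X : x k - w k ∈ X := ⟨fun l => (hx'B l).le, fun i => (h2 i).le⟩
  have hxX : x k ∈ X := mirrorMap_mem hne isClosed_feasibleSet convex_feasibleSet _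
  have hvi := inner_mirrorMap_le hne isClosed_feasibleSet convex_feasibleSet (z k) hx'X
  change ⟪z k - x k, x k - w k - x k⟫ ≤ 0 at hvi
  rw [sub_sub_cancel_left, inner_neg_right, inner_sub_left] at hvi
  have hsum0 : 0 ≤ ∑ l, |⟪rowVec B l, x k - p⟫| := Finset.sum_nonneg fun l _ => abs_nonneg _
  have hwle : ‖w k‖ ≤ K * ∑ l, |⟪rowVec B l, x k - p⟫| := by
    refine hK _ _ hsum0 ?_
    rintro _ ⟨l, rfl⟩
    rw [mul_one, real_inner_comm]
    exact Finset.single_le_sum (f := fun l => |⟪rowVec B l, x k - p⟫|)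
      (fun l _ => abs_nonneg _) (Finset.mem_univ l)
  have hv0 : ⟪v, x k - w k - p⟫ = 0 :=
    inner_eq_zero_of_sharp hp hc (fun y hy => by
      have h5 := hsharp y hy
      have : 0 ≤ δ * ∑ l, |⟪rowVec B l, y - p⟫| :=
        mul_nonneg hδ.le (Finset.sum_nonneg fun l _ => abs_nonneg _)
      linarith) (hwB k)
  have hvw : ⟪v, w k⟫ = ⟪v, x k - p⟫ := by
    rw [sub_right_comm, inner_sub_right] at hv0
    linarith
  have hvw' : δ / (K + 1) * ‖w k‖ ≤ -⟪v, w k⟫ := by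
    rw [hvw]
    refine le_trans ?_ (hsharp _ hxX)
    rw [div_mul_eq_mul_div, div_le_iff₀ (by positivity)]
    nlinarith
  have hzw : ⟪z k, w k⟫ = s k * (⟪v, w k⟫ + ⟪(s k)⁻¹ • z k - v, w k⟫) := by
    rw [inner_sub_left, inner_smul_left]
    simp only [conj_trivial]
    field_simp
    ring
  have hb1 : ⟪(s k)⁻¹ • z k - v, w k⟫ ≤ ‖(s k)⁻¹ • z k - v‖ * ‖w k‖ := real_inner_le_norm _ _
  have hb2 : -⟪x k, w k⟫ ≤ ‖x k‖ * ‖w k‖ :=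
    (neg_le_abs _).trans (abs_real_inner_le_norm _ _)
  have hb3 : -(⟪v, w k⟫ + ⟪(s k)⁻¹ • z k - v, w k⟫) ≤ (s k)⁻¹ * ‖x k‖ * ‖w k‖ := by
    rw [mul_assoc, inv_mul_eq_div, le_div_iff₀ h4]
    linarith
  -- If `w k ≠ 0`, the penalty `δ / (K + 1) * ‖w k‖` would be at most the error in `herr` times `‖w
  -- k‖`, against `h3`.
  have hw0 : w k = 0 := by
    rw [← norm_le_zero_iff]
    by_contra! hpos
    nlinarith
  ext l
  rw [← hx'B l, hw0, sub_zero]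

end Feasible

/-! ### Gradients relative to a convex set -/

section Gradient

variable {d : ℕ} {X : Set (Vec d)} {h : Vec d → ℝ} {g x w : Vec d}

lemma tendsto_slope_of_hasGradientWithinAt (hg : HasGradientWithinAt h g X x)
    (hw : ∀ᶠ t : ℝ in 𝓝[>] 0, x + t • w ∈ X) :
    Tendsto (fun t : ℝ => t⁻¹ * (h (x + t • w) - h x)) (𝓝[>] 0) (𝓝 ⟪g, w⟫) := by
  have h1 : Tendsto (fun t : ℝ => t • w) (𝓝[>] 0) (𝓝 0) := by
    have : Tendsto (fun t : ℝ => t • w) (𝓝 0) (𝓝 ((0 : ℝ) • w)) :=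
      Continuous.tendsto (by fun_prop) 0
    rw [zero_smul] at this
    exact this.mono_left nhdsWithin_le_nhds
  have h2 : Tendsto (fun t : ℝ => t⁻¹ • t • w) (𝓝[>] 0) (𝓝 w) := by
    refine tendsto_const_nhds.congr' ?_
    filter_upwards [self_mem_nhdsWithin] with t ht
    rw [smul_smul, inv_mul_cancel₀ (ne_of_gt ht), one_smul]
  have := hg.hasFDerivWithinAt.lim h1 hw h2
  simpa using this

lemma eventually_add_smul_sub_mem (hX : Convex ℝ X) {y : Vec d} (hx : x ∈ X) (hy : y ∈ X) :
    ∀ᶠ t : ℝ in 𝓝[>] 0, x + t • (y - x) ∈ X := by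
  filter_upwards [Ioc_mem_nhdsGT (zero_lt_one (α := ℝ))] with t ht
  exact hX.add_smul_sub_mem hx hy ⟨ht.1.le, ht.2⟩

lemma add_inner_le_of_convexOn (hh : ConvexOn ℝ X h) (hx : x ∈ X)
    (hg : HasGradientWithinAt h g X x) {y : Vec d} (hy : y ∈ X) :
    h x + ⟪g, y - x⟫ ≤ h y := by
  have hlim := tendsto_slope_of_hasGradientWithinAt hg (eventually_add_smul_sub_mem hh.1 hx hy)
  have : ⟪g, y - x⟫ ≤ h y - h x := by
    refine le_of_tendsto hlim ?_
    filter_upwards [Ioc_mem_nhdsGT (zero_lt_one (α := ℝ))] with t ht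
    have h1 := hh.2 hx hy (sub_nonneg.2 ht.2) ht.1.le (by ring)
    have h2 : x + t • (y - x) = (1 - t) • x + t • y := by module
    rw [h2, inv_mul_le_iff₀ ht.1]
    simp only [smul_eq_mul] at h1
    linarith
  linarith

/-- Only feasible directions are controlled, because a gradient relative to `X` is arbitrary in
directions that `X` does not see. -/
lemma abs_inner_le_of_lipschitz (hg : HasGradientWithinAt h g X x) {L : ℝ}
    (hL : ∀ y ∈ X, |h y - h x| ≤ L * ‖y - x‖) (hw : ∀ᶠ t : ℝ in 𝓝[>] 0, x + t • w ∈ X) :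
    |⟪g, w⟫| ≤ L * ‖w‖ := by
  refine le_of_tendsto (tendsto_slope_of_hasGradientWithinAt hg hw).abs ?_
  filter_upwards [hw, self_mem_nhdsWithin] with t ht ht0
  have ht0 : 0 < t := ht0
  have h1 := hL _ ht
  rw [add_sub_cancel_left, norm_smul, Real.norm_of_nonneg ht0.le] at h1
  rw [abs_mul, abs_of_pos (inv_pos.2 ht0), inv_mul_le_iff₀ ht0]
  linarith

lemma starProjection_vectorSpan_eq {u v : Vec d} (hx : x ∈ X)
    (h : ∀ y ∈ X, ⟪u, y - x⟫ = ⟪v, y - x⟫) :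
    (vectorSpan ℝ X).starProjection u = (vectorSpan ℝ X).starProjection v := by
  rw [← sub_eq_zero, ← map_sub, Submodule.starProjection_apply_eq_zero_iff,
    vectorSpan_eq_span_vsub_set_right ℝ hx, Submodule.mem_orthogonal']
  intro w hw
  induction hw using Submodule.span_induction with
  | mem w hw =>
    obtain ⟨y, hy, rfl⟩ := hw
    simp only [vsub_eq_sub, inner_sub_left, h y hy, sub_self]
  | zero => simp
  | add a b _ _ ha hb => rw [inner_add_right, ha, hb, add_zero]
  | smul a b _ hb => rw [inner_smul_right, hb, mul_zero]

end Gradient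

/-! ### Expected objectives -/

section Objective

variable {m d d₁ d₂ : ℕ} {B : Matrix (Fin d₁) (Fin d) ℝ} {b : Fin d₁ → ℝ}
  {C : Matrix (Fin d₂) (Fin d) ℝ} {c : Fin d₂ → ℝ}
  {Ξ : Fin m → Type*} [∀ j, MeasurableSpace (Ξ j)] {ν : (j : Fin m) → Measure (Ξ j)}
  {F : (j : Fin m) → Vec d → Ξ j → ℝ} {gradF : (j : Fin m) → Vec d → Ξ j → Vec d}

lemma exists_norm_starProjection_grad_le
    (hobj : ObjectiveAssumption (feasibleSet B b C c) F gradF ν) :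
    ∃ K : ℝ, 0 ≤ K ∧ ∀ j (L₀ : Ξ j → ℝ),
      (∀ s, ∀ x ∈ feasibleSet B b C c, ∀ y ∈ feasibleSet B b C c,
        |F j x s - F j y s| ≤ L₀ s * ‖x - y‖) →
      ∀ s, ∀ x ∈ feasibleSet B b C c,
        ‖(vectorSpan ℝ (feasibleSet B b C c)).starProjection (gradF j x s)‖ ≤ K * |L₀ s| := by
  obtain ⟨K, hK0, hK⟩ := exists_norm_starProjection_vectorSpan_le
    (Sum.elim (rowVec B) (rowVec C)) (Sum.elim b c)
  rw [← feasibleSet_eq_polyhedron] at hK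
  refine ⟨K, hK0, fun j L₀ hL s x hx => hK x hx _ _ (abs_nonneg _) fun w hw => ?_⟩
  refine abs_inner_le_of_lipschitz (hobj.hasGradient j s x hx) (fun y hy => ?_) hw
  exact (hL s y hy x hx).trans (mul_le_mul_of_nonneg_right (le_abs_self _) (norm_nonneg _))

lemma measurable_grad_apply {X : Set (Vec d)} (hobj : ObjectiveAssumption X F gradF ν) (j : Fin m)
    {x : Vec d} (hx : x ∈ X) : Measurable (gradF j x) :=
  (hobj.measurable_grad j).comp (measurable_const.prodMk measurable_id :
    Measurable fun s : Ξ j => ((⟨x, hx⟩ : X), s))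

/-- Differentiation under the integral along the segment from `x` to `y`; the difference quotients
are dominated by `|L₀ s| * ‖y - x‖`. -/
lemma integral_inner_grad {X : Set (Vec d)} (hX : Convex ℝ X)
    (hobj : ObjectiveAssumption X F gradF ν)
    {gradf : Fin m → Vec d → Vec d} [∀ j, IsProbabilityMeasure (ν j)] {j : Fin m} {x y : Vec d}
    (hx : x ∈ X) (hy : y ∈ X)
    (hf : HasGradientWithinAt (localObjective F ν j) (gradf j x) X x) :
    ∫ s, ⟪gradF j x s, y - x⟫ ∂(ν j) = ⟪gradf j x, y - x⟫ := by
  obtain ⟨p, L₀, hp, hL₀, hL₀p, hL⟩ := hobj.lipschitz j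
  have hp1 : (1 : ENNReal) ≤ ENNReal.ofReal p := by
    rw [ENNReal.one_le_ofReal]; linarith
  have hint : Integrable L₀ (ν j) := hL₀p.integrable hp1
  have hev := eventually_add_smul_sub_mem hX hx hy
  have h1 : Tendsto (fun t : ℝ => ∫ s, t⁻¹ * (F j (x + t • (y - x)) s - F j x s) ∂(ν j)) (𝓝[>] 0)
      (𝓝 (∫ s, ⟪gradF j x s, y - x⟫ ∂(ν j))) := by
    refine tendsto_integral_filter_of_dominated_convergence (fun s => |L₀ s| * ‖y - x‖) ?_ ?_
      (hint.abs.mul_const _) ?_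
    · filter_upwards [hev] with t ht
      exact (((hobj.integrable j _ ht).sub
        (hobj.integrable j x hx)).const_mul _).aestronglyMeasurable
    · filter_upwards [hev, self_mem_nhdsWithin] with t ht ht0
      have ht0 : 0 < t := ht0
      refine Eventually.of_forall fun s => ?_
      have h1 := hL s _ ht x hx
      rw [add_sub_cancel_left, norm_smul, Real.norm_of_nonneg ht0.le] at h1
      rw [norm_mul, Real.norm_of_nonneg (inv_pos.2 ht0).le, inv_mul_le_iff₀ ht0, Real.norm_eq_abs]
      have h2 := mul_le_mul_of_nonneg_right (le_abs_self (L₀ s))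
        (mul_nonneg ht0.le (norm_nonneg (y - x)))
      linarith
    · exact Eventually.of_forall fun s =>
        tendsto_slope_of_hasGradientWithinAt (hobj.hasGradient j s x hx) hev
  refine tendsto_nhds_unique h1 ((tendsto_slope_of_hasGradientWithinAt hf hev).congr' ?_)
  filter_upwards [hev] with t ht
  rw [integral_const_mul, integral_sub (hobj.integrable j _ ht) (hobj.integrable j x hx)]
  rfl

lemma convexOn_localObjective {X : Set (Vec d)} (hX : Convex ℝ X)
    (hobj : ObjectiveAssumption X F gradF ν) (j : Fin m) :
    ConvexOn ℝ X (localObjective F ν j) := by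
  refine ⟨hX, fun x hx y hy s t hs ht hst => ?_⟩
  unfold localObjective
  rw [smul_eq_mul, smul_eq_mul, ← integral_const_mul, ← integral_const_mul, ← integral_add
    ((hobj.integrable j x hx).const_mul _) ((hobj.integrable j y hy).const_mul _)]
  refine integral_mono (hobj.integrable j _ (hX hx hy hs ht hst))
    (((hobj.integrable j x hx).const_mul _).add ((hobj.integrable j y hy).const_mul _)) fun ω => ?_
  exact (hobj.convex j ω).2 hx hy hs ht hst

lemma exists_lipschitz_localObjective {X : Set (Vec d)} (hobj : ObjectiveAssumption X F gradF ν)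
    [∀ j, IsProbabilityMeasure (ν j)] (j : Fin m) :
    ∃ L : ℝ, 0 ≤ L ∧ ∀ x ∈ X, ∀ y ∈ X,
      |localObjective F ν j x - localObjective F ν j y| ≤ L * ‖x - y‖ := by
  obtain ⟨p, L₀, hp, hL₀, hL₀p, hL⟩ := hobj.lipschitz j
  have hp1 : (1 : ENNReal) ≤ ENNReal.ofReal p := by
    rw [ENNReal.one_le_ofReal]; linarith
  have hint : Integrable L₀ (ν j) := hL₀p.integrable hp1
  refine ⟨∫ s, |L₀ s| ∂(ν j), integral_nonneg fun _ => abs_nonneg _, fun x hx y hy => ?_⟩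
  unfold localObjective
  rw [← integral_sub (hobj.integrable j x hx) (hobj.integrable j y hy), ← integral_mul_const]
  rw [← Real.norm_eq_abs]
  refine norm_integral_le_of_norm_le (hint.abs.mul_const ‖x - y‖)
    (Eventually.of_forall fun s => ?_)
  exact (hL s x hx y hy).trans (mul_le_mul_of_nonneg_right (le_abs_self _) (norm_nonneg _))

/-- The minimizer is unique under nondegeneracy and restricted strong convexity. -/
lemma eq_of_isMinOn {gradf : Fin m → Vec d → Vec d} {hess : Vec d →L[ℝ] Vec d} {p : Vec d}
    (hpX : p ∈ feasibleSet B b C c)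
    (hobj : ObjectiveAssumption (feasibleSet B b C c) F gradF ν)
    (hreg : RegularityAssumption (feasibleSet B b C c) B F ν gradf hess p)
    (hmin : IsMinOn (objective F ν) (feasibleSet B b C c) p)
    {δ : ℝ} (hδ : 0 < δ)
    (hsharp : ∀ x ∈ feasibleSet B b C c,
      δ * ∑ l, |⟪rowVec B l, x - p⟫| ≤ -⟪-∑ j, gradf j p, x - p⟫)
    {x : Vec d} (hx : x ∈ feasibleSet B b C c) (hfx : objective F ν x = objective F ν p) :
    x = p := by
  set X := feasibleSet B b C c with hXdef
  have hX : Convex ℝ X := convex_feasibleSet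
  have hconv : ConvexOn ℝ X (objective F ν) := by
    have := fun j => convexOn_localObjective hX hobj j
    unfold objective
    refine ⟨hX, fun x hx y hy s t hs ht hst => ?_⟩
    rw [smul_eq_mul, smul_eq_mul, Finset.mul_sum, Finset.mul_sum, ← Finset.sum_add_distrib]
    exact Finset.sum_le_sum fun j _ => (this j).2 hx hy hs ht hst
  have hgrad : ∀ y ∈ X, HasGradientWithinAt (objective F ν) (∑ j, gradf j y) X y := by
    intro y hy
    rw [hasGradientWithinAt_iff_hasFDerivWithinAt, map_sum]
    exact HasFDerivWithinAt.fun_sum fun j _ => (hreg.hasGradient j y hy).hasFDerivWithinAt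
  set u := x - p with hu
  -- By convexity the whole segment from `p` to `x` consists of minimizers, so the gradient at its
  -- points has no positive component along `u`.
  have hseg : ∀ t : ℝ, 0 ≤ t → t ≤ 1 →
      p + t • u ∈ X ∧ objective F ν (p + t • u) = objective F ν p := by
    intro t ht ht1
    have hmem : p + t • u ∈ X := hX.add_smul_sub_mem hpX hx ⟨ht, ht1⟩
    refine ⟨hmem, le_antisymm ?_ (hmin hmem)⟩
    have h1 := hconv.2 hpX hx (sub_nonneg.2 ht1) ht (by ring)
    have h2 : p + t • u = (1 - t) • p + t • x := by rw [hu]; module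
    rw [h2]
    simp only [smul_eq_mul, hfx] at h1
    linarith
  have hzero : ∀ t : ℝ, 0 ≤ t → t < 1 → ⟪∑ j, gradf j (p + t • u), u⟫ ≤ 0 := by
    intro t ht ht1
    obtain ⟨hmem, hval⟩ := hseg t ht ht1.le
    have h1 := add_inner_le_of_convexOn hconv hmem (hgrad _ hmem) hx
    have h2 : x - (p + t • u) = (1 - t) • u := by rw [hu]; module
    rw [hval, hfx, h2, inner_smul_right] at h1
    nlinarith
  have hzero' : 0 ≤ ⟪∑ j, gradf j p, u⟫ := by
    have := hsharp x hx
    rw [inner_neg_left, neg_neg] at this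
    exact le_trans (mul_nonneg hδ.le (Finset.sum_nonneg fun _ _ => abs_nonneg _)) this
  have h0 : ⟪∑ j, gradf j p, u⟫ = 0 := by
    have := hzero 0 le_rfl zero_lt_one
    rw [zero_smul, add_zero] at this
    exact le_antisymm this hzero'
  -- The gradient at `p` annihilates `u`, so sharpness leaves no room for `B u ≠ 0`, and restricted
  -- strong convexity applies to `u`.
  have hBu : B *ᵥ u.ofLp = 0 := by
    have h1 := hsharp x hx
    rw [inner_neg_left, neg_neg, h0] at h1
    have h2 : ∑ l, |⟪rowVec B l, u⟫| ≤ 0 := nonpos_of_mul_nonpos_right h1 hδ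
    ext l
    have h3 := Finset.single_le_sum (f := fun l => |⟪rowVec B l, u⟫|)
      (fun l _ => abs_nonneg _) (Finset.mem_univ l)
    have h4 := abs_nonpos_iff.1 (h3.trans h2)
    rwa [inner_rowVec] at h4
  obtain ⟨κ, hκ, hκ'⟩ := hreg.restrictedStrongConvexity
  obtain ⟨c₀, hc₀, ε, hε, hexp⟩ := hreg.expansion
  have hcv := hκ' u hBu
  -- At `p + t • u` the curvature term `t κ ‖u‖²` must be absorbed by the remainder `c₀ t² ‖u‖³`;
  -- dividing by `t` and letting `t → 0` gives `u = 0`.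
  have hev : ∀ᶠ t : ℝ in 𝓝[>] 0, κ * ‖u‖ ^ 2 ≤ c₀ * t * ‖u‖ ^ 3 := by
    have hc : Tendsto (fun t : ℝ => t * ‖u‖) (𝓝[>] 0) (𝓝 0) := by
      have : Tendsto (fun t : ℝ => t * ‖u‖) (𝓝 0) (𝓝 (0 * ‖u‖)) :=
        Continuous.tendsto (by fun_prop) 0
      rw [zero_mul] at this
      exact this.mono_left nhdsWithin_le_nhds
    filter_upwards [hc.eventually_lt_const hε, Ioo_mem_nhdsGT (zero_lt_one (α := ℝ))]
      with t ht ht1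
    have hn : ‖p + t • u - p‖ = t * ‖u‖ := by
      rw [add_sub_cancel_left, norm_smul, Real.norm_of_nonneg ht1.1.le]
    have h1 := hexp _ (hseg t ht1.1.le ht1.2.le).1 (by rw [hn]; exact ht.le)
    have h2 := abs_real_inner_le_norm
      ((∑ j, gradf j (p + t • u)) - (∑ j, gradf j p) - hess (p + t • u - p)) u
    rw [hn] at h1
    have h3 := h2.trans (mul_le_mul_of_nonneg_right h1 (norm_nonneg u))
    rw [add_sub_cancel_left, map_smul, inner_sub_left, inner_sub_left, inner_smul_left, h0] at h3
    simp only [conj_trivial, sub_zero] at h3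
    have h4 := hzero t ht1.1.le ht1.2
    have h5 := (neg_le_abs _).trans h3
    rw [real_inner_comm] at hcv
    have h6 : t * (κ * ‖u‖ ^ 2) ≤ t * (c₀ * t * ‖u‖ ^ 3) := by nlinarith [ht1.1]
    exact le_of_mul_le_mul_left h6 ht1.1
  have hlim : Tendsto (fun t : ℝ => c₀ * t * ‖u‖ ^ 3) (𝓝[>] 0) (𝓝 0) := by
    have : Tendsto (fun t : ℝ => c₀ * t * ‖u‖ ^ 3) (𝓝 0) (𝓝 (c₀ * 0 * ‖u‖ ^ 3)) :=
      Continuous.tendsto (by fun_prop) 0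
    simp only [mul_zero, zero_mul] at this
    exact this.mono_left nhdsWithin_le_nhds
  have hfin := ge_of_tendsto hlim hev
  have : ‖u‖ ^ 2 ≤ 0 := nonpos_of_mul_nonpos_right hfin hκ
  have hu0 : ‖u‖ = 0 := by
    have h1 : ‖u‖ ^ 2 = 0 := le_antisymm this (sq_nonneg _)
    exact pow_eq_zero_iff (two_ne_zero) |>.1 h1
  exact sub_eq_zero.1 (norm_eq_zero.1 hu0)

end Objective

/-! ### Sums of fresh centred noise -/

section Noise

variable {Ω S Ξ : Type*} {𝒢 : MeasurableSpace Ω} [mΩ : MeasurableSpace Ω] [MeasurableSpace S]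
  [MeasurableSpace Ξ] {μ : Measure Ω}

/-- A function of a known state and a fresh sample that is centred for every frozen state is
orthogonal to every known random variable. -/
lemma integral_mul_fresh_eq_zero [IsProbabilityMeasure μ] (h𝒢 : 𝒢 ≤ mΩ) {W : Ω → ℝ}
    (hW : Measurable[𝒢] W) {U : Ω → S} (hU : Measurable[𝒢] U) {ζ : Ω → Ξ} (hζ : Measurable ζ)
    (hind : Indep (MeasurableSpace.comap ζ inferInstance) 𝒢 μ) {h : S × Ξ → ℝ} (hh : Measurable h)
    (hzero : ∀ u, ∫ s, h (u, s) ∂(μ.map ζ) = 0) :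
    ∫ ω, W ω * h (U ω, ζ ω) ∂μ = 0 := by
  -- A product that is not integrable has integral `0` by convention. Otherwise the pair `(W, U)` is
  -- independent of `ζ`, and Fubini freezes the state.
  by_cases hint : Integrable (fun ω => W ω * h (U ω, ζ ω)) μ
  swap
  · exact integral_undef hint
  have hWU : Measurable[𝒢] fun ω => (W ω, U ω) := hW.prodMk hU
  have hWU' : Measurable fun ω => (W ω, U ω) := hWU.mono h𝒢 le_rfl
  have hIF : IndepFun (fun ω => (W ω, U ω)) ζ μ := by
    rw [IndepFun_iff_Indep]
    exact (indep_of_indep_of_le_right hind hWU.comap_le).symm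
  have hlaw := (indepFun_iff_map_prod_eq_prod_map_map hWU'.aemeasurable hζ.aemeasurable).1 hIF
  have hk : Measurable fun q : (ℝ × S) × Ξ => q.1.1 * h (q.1.2, q.2) := by fun_prop
  have hpair : Measurable fun ω => ((W ω, U ω), ζ ω) := hWU'.prodMk hζ
  have : IsProbabilityMeasure (μ.map ζ) := Measure.isProbabilityMeasure_map hζ.aemeasurable
  have : IsProbabilityMeasure (μ.map fun ω => (W ω, U ω)) :=
    Measure.isProbabilityMeasure_map hWU'.aemeasurable
  have hint' : Integrable (fun q : (ℝ × S) × Ξ => q.1.1 * h (q.1.2, q.2))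
      ((μ.map fun ω => (W ω, U ω)).prod (μ.map ζ)) := by
    rw [← hlaw, integrable_map_measure hk.aestronglyMeasurable hpair.aemeasurable]
    exact hint
  calc ∫ ω, W ω * h (U ω, ζ ω) ∂μ
      = ∫ q, q.1.1 * h (q.1.2, q.2) ∂(μ.map fun ω => ((W ω, U ω), ζ ω)) :=
        (integral_map hpair.aemeasurable hk.aestronglyMeasurable).symm
    _ = 0 := by
      rw [hlaw, integral_prod _ hint']
      simp only [integral_const_mul, hzero, mul_zero, integral_zero]

/-- A series of fresh centred noise terms with summable variances converges almost surely. -/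
lemma ae_exists_tendsto_sum_fresh [IsProbabilityMeasure μ] (𝒢 : Filtration ℕ mΩ) {U : ℕ → Ω → S}
    (hU : ∀ k, Measurable[𝒢 k] (U k)) {ζ : ℕ → Ω → Ξ} (hζ : ∀ k, Measurable[𝒢 (k + 1)] (ζ k))
    (hind : ∀ k, Indep (MeasurableSpace.comap (ζ k) inferInstance) (𝒢 k) μ)
    {h : ℕ → S × Ξ → ℝ} (hh : ∀ k, Measurable (h k))
    (hzero : ∀ k u, ∫ s, h k (u, s) ∂(μ.map (ζ k)) = 0)
    (hL2 : ∀ k, MemLp (fun ω => h k (U k ω, ζ k ω)) 2 μ)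
    (hsum : Summable fun k => ∫ ω, (h k (U k ω, ζ k ω)) ^ 2 ∂μ) :
    ∀ᵐ ω ∂μ, ∃ l : ℝ,
      Tendsto (fun n => ∑ k ∈ Finset.range n, h k (U k ω, ζ k ω)) atTop (𝓝 l) := by
  set D : ℕ → Ω → ℝ := fun k ω => h k (U k ω, ζ k ω) with hD
  set T : ℕ → Ω → ℝ := fun n ω => ∑ k ∈ Finset.range n, D k ω with hT
  have hDm : ∀ k, Measurable[𝒢 (k + 1)] (D k) := fun k =>
    (hh k).comp (((hU k).mono (𝒢.mono k.le_succ) le_rfl).prodMk (hζ k))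
  have hTm : ∀ n, Measurable[𝒢 n] (T n) := fun n =>
    Finset.measurable_sum _ fun k hk =>
      (hDm k).mono (𝒢.mono (Nat.succ_le_of_lt (Finset.mem_range.1 hk))) le_rfl
  have hT2 : ∀ n, MemLp (T n) 2 μ := fun n => memLp_finsetSum _ fun k _ => hL2 k
  have hζ' : ∀ k, Measurable (ζ k) := fun k => (hζ k).mono (𝒢.le _) le_rfl
  -- Used twice: indicators `W` give the martingale property, and `W = T k` gives orthogonality of
  -- the increments.
  have horth : ∀ k (W : Ω → ℝ), Measurable[𝒢 k] W → ∫ ω, W ω * D k ω ∂μ = 0 := fun k W hW =>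
    integral_mul_fresh_eq_zero (𝒢.le k) hW (hU k) (hζ' k) (hind k) (hh k) (hzero k)
  have hDint : ∀ k, Integrable (D k) μ := fun k => (hL2 k).integrable one_le_two
  have hTint : ∀ n, Integrable (T n) μ := fun n => (hT2 n).integrable one_le_two
  have hmart : Martingale T 𝒢 μ := by
    refine martingale_of_setIntegral_eq_succ (fun n => (hTm n).stronglyMeasurable) hTint
      fun n s hs => ?_
    have h1 : ∀ ω, T (n + 1) ω = T n ω + D n ω := fun ω => Finset.sum_range_succ _ _
    simp only [h1]
    rw [integral_add (hTint n).integrableOn (hDint n).integrableOn]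
    have h2 := horth n (s.indicator fun _ => 1) (measurable_const.indicator hs)
    have h3 : ∀ ω, s.indicator (fun _ => (1 : ℝ)) ω * D n ω = s.indicator (D n) ω := by
      intro ω
      by_cases hω : ω ∈ s <;> simp [hω]
    simp only [h3] at h2
    rw [integral_indicator (𝒢.le n s hs)] at h2
    rw [h2, add_zero]
  have hsq : ∀ n, ∫ ω, T n ω ^ 2 ∂μ = ∑ k ∈ Finset.range n, ∫ ω, D k ω ^ 2 ∂μ := by
    intro n
    induction n with
    | zero => simp [hT]
    | succ n ih =>
      rw [Finset.sum_range_succ, ← ih]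
      have h1 : ∀ ω, T (n + 1) ω ^ 2 = T n ω ^ 2 + 2 * (T n ω * D n ω) + D n ω ^ 2 := by
        intro ω
        have : T (n + 1) ω = T n ω + D n ω := Finset.sum_range_succ _ _
        rw [this]; ring
      have hmul : Integrable (fun ω => T n ω * D n ω) μ := (hT2 n).integrable_mul (hL2 n)
      have hTsq : Integrable (fun ω => T n ω ^ 2) μ := (hT2 n).integrable_sq
      have hDsq : Integrable (fun ω => D n ω ^ 2) μ := (hL2 n).integrable_sq
      have hadd : Integrable (fun ω => T n ω ^ 2 + 2 * (T n ω * D n ω)) μ :=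
        hTsq.add (hmul.const_mul 2)
      simp only [h1]
      rw [integral_add hadd hDsq, integral_add hTsq (hmul.const_mul 2), integral_const_mul,
        horth n (T n) (hTm n), mul_zero, add_zero]
  set M := ∑' k, ∫ ω, D k ω ^ 2 ∂μ with hM
  -- From `|T| ≤ 1 + T²`, the variance bound gives the `L¹` bound needed for martingale convergence.
  have hbdd : ∀ n, eLpNorm (T n) 1 μ ≤ ((1 + M).toNNReal : ENNReal) := by
    intro n
    rw [eLpNorm_one_eq_lintegral_enorm, ← ofReal_integral_norm_eq_lintegral_enorm (hTint n)]
    refine ENNReal.ofReal_le_ofReal ?_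
    have h1 : ∫ ω, ‖T n ω‖ ∂μ ≤ ∫ ω, (1 + T n ω ^ 2) ∂μ := by
      refine integral_mono (hTint n).norm ((integrable_const 1).add (hT2 n).integrable_sq)
        fun ω => ?_
      have := sq_nonneg (|T n ω| - 1)
      rw [Real.norm_eq_abs]
      nlinarith [sq_abs (T n ω), abs_nonneg (T n ω)]
    refine h1.trans ?_
    rw [integral_add (integrable_const 1) (hT2 n).integrable_sq, hsq]
    simp only [integral_const, probReal_univ, smul_eq_mul, mul_one]
    have := hsum.sum_le_tsum (Finset.range n) fun k _ => integral_nonneg fun ω => sq_nonneg (D k ω)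
    linarith
  exact hmart.submartingale.exists_ae_tendsto_of_bdd hbdd

/-- A series of nonnegative random variables with summable expectations converges almost surely. -/
lemma ae_summable_of_summable_integral {f : ℕ → Ω → ℝ} (hf0 : ∀ k ω, 0 ≤ f k ω)
    (hint : ∀ k, Integrable (f k) μ) (hsum : Summable fun k => ∫ ω, f k ω ∂μ) :
    ∀ᵐ ω ∂μ, Summable fun k => f k ω := by
  have h1 : ∫⁻ ω, ∑' k, ENNReal.ofReal (f k ω) ∂μ ≠ ⊤ := by
    rw [lintegral_tsum fun k => (hint k).aestronglyMeasurable.aemeasurable.ennreal_ofReal]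
    have : ∀ k, ∫⁻ ω, ENNReal.ofReal (f k ω) ∂μ = ENNReal.ofReal (∫ ω, f k ω ∂μ) := fun k =>
      (ofReal_integral_eq_lintegral_ofReal (hint k) (Eventually.of_forall (hf0 k))).symm
    simp only [this]
    exact hsum.tsum_ofReal_ne_top
  have h2 := ae_lt_top' (AEMeasurable.tsum fun k =>
    (hint k).aestronglyMeasurable.aemeasurable.ennreal_ofReal) h1
  filter_upwards [h2] with ω hω
  have := ENNReal.summable_toReal hω.ne
  simpa only [ENNReal.toReal_ofReal (hf0 _ ω)] using this

end Noise

/-! ### Consensus -/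

/-- Summing the recursion and moving `r ∑ V` to the left bounds the partial sums by `(V 0 + ∑ c) /
(1 - r)`. -/
lemma summable_of_le_mul_add {V c : ℕ → ℝ} {r : ℝ} (hr : r < 1) (hV : ∀ k, 0 ≤ V k)
    (hc : Summable c) (hc0 : ∀ k, 0 ≤ c k) (h : ∀ k, V (k + 1) ≤ r * V k + c k) :
    Summable V := by
  have hb : ∀ n, (1 - r) * ∑ k ∈ Finset.range n, V k ≤ V 0 + ∑' k, c k := by
    intro n
    have h1 : ∑ k ∈ Finset.range (n + 1), V k ≤
        V 0 + r * (∑ k ∈ Finset.range n, V k) + ∑ k ∈ Finset.range n, c k := by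
      rw [Finset.sum_range_succ', Finset.mul_sum, add_comm, add_assoc, ← Finset.sum_add_distrib]
      gcongr with k _
      exact h k
    have h2 := hc.sum_le_tsum (Finset.range n) fun k _ => hc0 k
    rw [Finset.sum_range_succ] at h1
    linarith [hV n]
  refine summable_of_sum_range_le (c := (V 0 + ∑' k, c k) / (1 - r)) hV fun n => ?_
  rw [le_div_iff₀ (by linarith), mul_comm]
  exact hb n

section Average

variable {m : ℕ} {E : Type*} [NormedAddCommGroup E] [InnerProductSpace ℝ E]

/-- The mean of a finite family of vectors. -/
noncomputable def mean (v : Fin m → E) : E := (m : ℝ)⁻¹ • ∑ j, v j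

lemma sum_sub_mean (hm : 0 < m) (v : Fin m → E) : ∑ j, (v j - mean v) = 0 := by
  have : (m : ℝ) ≠ 0 := by positivity
  rw [Finset.sum_sub_distrib, Finset.sum_const, Finset.card_univ, Fintype.card_fin, mean,
    ← Nat.cast_smul_eq_nsmul ℝ, smul_smul, mul_inv_cancel₀ this, one_smul, sub_self]

lemma sum_norm_sub_mean_sq_le (hm : 0 < m) (v : Fin m → E) :
    ∑ j, ‖v j - mean v‖ ^ 2 ≤ ∑ j, ‖v j‖ ^ 2 := by
  have h1 : ∀ j, ‖v j‖ ^ 2 = ‖v j - mean v‖ ^ 2 + 2 * ⟪v j - mean v, mean v⟫ + ‖mean v‖ ^ 2 := by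
    intro j
    rw [← norm_add_sq_real, sub_add_cancel]
  simp only [h1, Finset.sum_add_distrib, ← Finset.mul_sum, ← sum_inner, sum_sub_mean hm,
    inner_zero_left, mul_zero, add_zero]
  have : 0 ≤ ∑ _j : Fin m, ‖mean v‖ ^ 2 := Finset.sum_nonneg fun _ _ => sq_nonneg _
  linarith

lemma norm_mean_sq_le (hm : 0 < m) (v : Fin m → E) :
    ‖mean v‖ ^ 2 ≤ (m : ℝ)⁻¹ * ∑ j, ‖v j‖ ^ 2 := by
  have hm' : (0 : ℝ) < m := by positivity
  have h1 : ‖mean v‖ ≤ (m : ℝ)⁻¹ * ∑ j, ‖v j‖ := by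
    rw [mean, norm_smul, norm_inv, Real.norm_natCast]
    exact mul_le_mul_of_nonneg_left (norm_sum_le _ _) (by positivity)
  have h2 := sq_sum_le_card_mul_sum_sq (s := Finset.univ) (f := fun j => ‖v j‖)
  rw [Finset.card_univ, Fintype.card_fin] at h2
  calc ‖mean v‖ ^ 2 ≤ ((m : ℝ)⁻¹ * ∑ j, ‖v j‖) ^ 2 :=
        pow_le_pow_left₀ (norm_nonneg _) h1 2
    _ = (m : ℝ)⁻¹ * ((m : ℝ)⁻¹ * (∑ j, ‖v j‖) ^ 2) := by ring
    _ ≤ (m : ℝ)⁻¹ * ((m : ℝ)⁻¹ * (m * ∑ j, ‖v j‖ ^ 2)) := by gcongr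
    _ = (m : ℝ)⁻¹ * ∑ j, ‖v j‖ ^ 2 := by rw [inv_mul_cancel_left₀ hm'.ne']

lemma mean_sum_smul {A : Matrix (Fin m) (Fin m) ℝ} (hA : A ∈ doublyStochastic ℝ (Fin m))
    (v : Fin m → E) : mean (fun j => ∑ i, A j i • v i) = mean v := by
  unfold mean
  rw [Finset.sum_comm]
  congr 1
  refine Finset.sum_congr rfl fun i _ => ?_
  rw [← Finset.sum_smul, sum_col_of_mem_doublyStochastic hA, one_smul]

lemma mean_sub_smul (v u : Fin m → E) (a : ℝ) :
    mean (fun j => v j - a • u j) = mean v - a • mean u := by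
  simp only [mean, Finset.sum_sub_distrib, ← Finset.smul_sum, smul_sub]
  rw [smul_comm]

lemma disagreement_apply {A : Matrix (Fin m) (Fin m) ℝ} (hA : A ∈ doublyStochastic ℝ (Fin m))
    (i i' : Fin m) : disagreement A i i' = ∑ j, A j i * A j i' - (m : ℝ)⁻¹ := by
  have h1 : Aᵀ * averaging m * A = averaging m := by
    ext k l
    simp only [Matrix.mul_apply, averaging, Matrix.of_apply, Matrix.transpose_apply,
      ← Finset.sum_mul, sum_col_of_mem_doublyStochastic hA, one_mul, ← Finset.mul_sum, mul_one]
  rw [disagreement, Matrix.mul_sub, Matrix.sub_mul, mul_one, h1]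
  simp [Matrix.mul_apply, averaging]

/-- The left side is the quadratic form of `AᵀA`. On families with sum zero the averaging part
contributes nothing, so `AᵀA` may be replaced by the matrix whose expectation has norm below `1`. -/
lemma sum_norm_sum_smul_sq {A : Matrix (Fin m) (Fin m) ℝ} (hA : A ∈ doublyStochastic ℝ (Fin m))
    {v : Fin m → E} (hv : ∑ i, v i = 0) :
    ∑ j, ‖∑ i, A j i • v i‖ ^ 2 = ∑ i, ∑ i', disagreement A i i' * ⟪v i, v i'⟫ := by
  have h0 : ∑ i, ∑ i', (m : ℝ)⁻¹ * ⟪v i, v i'⟫ = 0 := by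
    simp only [← Finset.mul_sum, ← inner_sum, hv, inner_zero_right, mul_zero,
      Finset.sum_const_zero]
  simp only [disagreement_apply hA, sub_mul, Finset.sum_sub_distrib, h0, sub_zero]
  simp only [← real_inner_self_eq_norm_sq, sum_inner, inner_sum, inner_smul_left,
    inner_smul_right, conj_trivial, Finset.sum_mul, Finset.mul_sum]
  rw [Finset.sum_comm]
  refine Finset.sum_congr rfl fun i _ => ?_
  rw [Finset.sum_comm]
  refine Finset.sum_congr rfl fun i' _ => Finset.sum_congr rfl fun j _ => ?_
  rw [real_inner_comm]
  ring

/-- The form splits over the `d` coordinates; `x k` collects the `k`-th coordinate of all agents,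
and the operator norm bound applies to each. -/
lemma sum_mul_inner_le {d : ℕ} (M : Matrix (Fin m) (Fin m) ℝ) (v : Fin m → Vec d) :
    ∑ i, ∑ i', M i i' * ⟪v i, v i'⟫ ≤
      ‖Matrix.toEuclideanCLM (𝕜 := ℝ) (n := Fin m) M‖ * ∑ i, ‖v i‖ ^ 2 := by
  set x : Fin d → Vec m := fun k => WithLp.toLp 2 fun i => v i k with hx
  have h1 : ∑ i, ∑ i', M i i' * ⟪v i, v i'⟫ =
      ∑ k, ⟪x k, Matrix.toEuclideanCLM (𝕜 := ℝ) (n := Fin m) M (x k)⟫ := by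
    simp only [PiLp.inner_apply, Matrix.ofLp_toEuclideanCLM, Matrix.mulVec, dotProduct, hx,
      RCLike.inner_apply, conj_trivial, Finset.mul_sum, Finset.sum_mul]
    rw [Finset.sum_comm' (s := Finset.univ) (t := fun _ => Finset.univ)
      (t' := Finset.univ) (s' := fun _ => Finset.univ) (by simp)]
    simp_rw [Finset.sum_comm (s := (Finset.univ : Finset (Fin m)))
      (t := (Finset.univ : Finset (Fin d)))]
    refine Finset.sum_congr rfl fun k _ => ?_
    rw [Finset.sum_comm]
    refine Finset.sum_congr rfl fun i _ => Finset.sum_congr rfl fun i' _ => by ring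
  have h2 : ∑ i, ‖v i‖ ^ 2 = ∑ k, ‖x k‖ ^ 2 := by
    simp only [EuclideanSpace.norm_sq_eq, hx]
    rw [Finset.sum_comm]
  rw [h1, h2, Finset.mul_sum]
  refine Finset.sum_le_sum fun k _ => ?_
  calc _ ≤ ‖x k‖ * ‖Matrix.toEuclideanCLM (𝕜 := ℝ) (n := Fin m) M (x k)‖ := real_inner_le_norm _ _
    _ ≤ ‖x k‖ * (‖Matrix.toEuclideanCLM (𝕜 := ℝ) (n := Fin m) M‖ * ‖x k‖) := by
      gcongr; exact ContinuousLinearMap.le_opNorm _ _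
    _ = _ := by ring

lemma norm_add_sq_le_mul {E : Type*} [SeminormedAddCommGroup E] (x y : E) {η : ℝ} (hη : 0 < η) :
    ‖x + y‖ ^ 2 ≤ (1 + η) * ‖x‖ ^ 2 + (1 + η⁻¹) * ‖y‖ ^ 2 := by
  have h1 := pow_le_pow_left₀ (norm_nonneg _) (norm_add_le x y) 2
  have h2 : 2 * (‖x‖ * ‖y‖) ≤ η * ‖x‖ ^ 2 + η⁻¹ * ‖y‖ ^ 2 := by
    have := mul_nonneg (inv_nonneg.2 hη.le) (sq_nonneg (η * ‖x‖ - ‖y‖))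
    have h3 : η⁻¹ * (η * ‖x‖ - ‖y‖) ^ 2 =
        η * ‖x‖ ^ 2 - 2 * (‖x‖ * ‖y‖) + η⁻¹ * ‖y‖ ^ 2 := by
      field_simp
      ring
    linarith
  nlinarith

end Average

section Consensus

variable {m d : ℕ} {Ω : Type*} {𝒢 : MeasurableSpace Ω} [mΩ : MeasurableSpace Ω] {μ : Measure Ω}

lemma measurable_entry (i j : Fin m) :
    Measurable fun A : Matrix (Fin m) (Fin m) ℝ => A i j :=
  (measurable_pi_apply j).comp (measurable_pi_apply (X := fun _ : Fin m => Fin m → ℝ) i)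

lemma measurable_disagreement (i j : Fin m) :
    Measurable fun A : Matrix (Fin m) (Fin m) ℝ => disagreement A i j := by
  simp only [disagreement, Matrix.mul_apply, Matrix.transpose_apply]
  exact Finset.measurable_sum _ fun k _ => (Finset.measurable_sum _ fun l _ =>
    (measurable_entry _ _).mul measurable_const).mul (measurable_entry _ _)

lemma abs_disagreement_le {A : Matrix (Fin m) (Fin m) ℝ} (hA : A ∈ doublyStochastic ℝ (Fin m))
    (i i' : Fin m) : |disagreement A i i'| ≤ m + (m : ℝ)⁻¹ := by
  rw [disagreement_apply hA]
  refine (abs_sub _ _).trans (add_le_add ?_ (abs_of_nonneg (by positivity)).le)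
  have : ∀ j, |A j i * A j i'| ≤ 1 := by
    intro j
    have h1 := nonneg_of_mem_doublyStochastic hA (i := j) (j := i)
    have h2 := nonneg_of_mem_doublyStochastic hA (i := j) (j := i')
    have h3 := le_one_of_mem_doublyStochastic hA (i := j) (j := i)
    have h4 := le_one_of_mem_doublyStochastic hA (i := j) (j := i')
    rw [abs_of_nonneg (mul_nonneg h1 h2)]
    exact mul_le_one₀ h3 h2 h4
  refine (Finset.abs_sum_le_sum_abs _ _).trans ((Finset.sum_le_sum fun j _ => this j).trans ?_)
  simp

/-- One step of averaging with an independent random weight matrix contracts disagreement in mean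
square. -/
lemma integral_sum_norm_sum_smul_sq_le [IsProbabilityMeasure μ]
    {A : Ω → Matrix (Fin m) (Fin m) ℝ} (hA : Measurable A)
    (hst : ∀ᵐ ω ∂μ, A ω ∈ doublyStochastic ℝ (Fin m))
    (hind : Indep (MeasurableSpace.comap A inferInstance) 𝒢 μ) {v : Fin m → Ω → Vec d}
    (hv : ∀ i, Measurable[𝒢] (v i)) (hv2 : ∀ i, MemLp (v i) 2 μ) (hv0 : ∀ ω, ∑ i, v i ω = 0) :
    ∫ ω, ∑ j, ‖∑ i, A ω j i • v i ω‖ ^ 2 ∂μ ≤ mixingNorm μ A * ∫ ω, ∑ i, ‖v i ω‖ ^ 2 ∂μ := by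
  have hinner : ∀ i i', Integrable (fun ω => ⟪v i ω, v i' ω⟫) μ := fun i i' =>
    ((hv2 i).norm.integrable_mul (hv2 i').norm).mono'
      ((hv2 i).aestronglyMeasurable.inner (hv2 i').aestronglyMeasurable)
      (Eventually.of_forall fun ω => norm_inner_le_norm _ _)
  have hD : ∀ i i', Measurable fun ω => disagreement (A ω) i i' := fun i i' =>
    (measurable_disagreement i i').comp hA
  have hDint : ∀ i i', Integrable (fun ω => disagreement (A ω) i i') μ := by
    intro i i'
    refine Integrable.of_bound (hD i i').aestronglyMeasurable (m + (m : ℝ)⁻¹) ?_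
    filter_upwards [hst] with ω hω using abs_disagreement_le hω i i'
  -- The inner products are known to `𝒢`, so the expectation factors entry by entry and only the
  -- mean disagreement matrix remains.
  have hIF : ∀ i i', IndepFun (fun ω => disagreement (A ω) i i') (fun ω => ⟪v i ω, v i' ω⟫) μ := by
    intro i i'
    rw [IndepFun_iff_Indep]
    refine indep_of_indep_of_le_right (indep_of_indep_of_le_left hind ?_) ?_
    · exact ((measurable_disagreement i i').comp (comap_measurable A)).comap_le
    · exact ((hv i).inner (hv i')).comap_le
  have hprod : ∀ i i', Integrable (fun ω => disagreement (A ω) i i' * ⟪v i ω, v i' ω⟫) μ :=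
    fun i i' => (hIF i i').integrable_mul (hDint i i') (hinner i i')
  calc ∫ ω, ∑ j, ‖∑ i, A ω j i • v i ω‖ ^ 2 ∂μ
      = ∫ ω, ∑ i, ∑ i', disagreement (A ω) i i' * ⟪v i ω, v i' ω⟫ ∂μ := by
        refine integral_congr_ae ?_
        filter_upwards [hst] with ω hω using sum_norm_sum_smul_sq hω (hv0 ω)
    _ = ∑ i, ∑ i', (∫ ω, disagreement (A ω) i i' ∂μ) * ∫ ω, ⟪v i ω, v i' ω⟫ ∂μ := by
        rw [integral_finsetSum _ fun i _ => integrable_finsetSum _ fun i' _ => hprod i i']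
        refine Finset.sum_congr rfl fun i _ => ?_
        rw [integral_finsetSum _ fun i' _ => hprod i i']
        refine Finset.sum_congr rfl fun i' _ => ?_
        exact (hIF i i').integral_fun_mul_eq_mul_integral (hDint i i').aestronglyMeasurable
          (hinner i i').aestronglyMeasurable
    _ = ∫ ω, ∑ i, ∑ i', (Matrix.of fun i j => ∫ ω, disagreement (A ω) i j ∂μ) i i' *
          ⟪v i ω, v i' ω⟫ ∂μ := by
        simp only [Matrix.of_apply]
        rw [integral_finsetSum _ fun i _ => integrable_finsetSum _ fun i' _ =>
          (hinner i i').const_mul _]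
        refine Finset.sum_congr rfl fun i _ => ?_
        rw [integral_finsetSum _ fun i' _ => (hinner i i').const_mul _]
        refine Finset.sum_congr rfl fun i' _ => ?_
        rw [integral_const_mul]
    _ ≤ ∫ ω, mixingNorm μ A * ∑ i, ‖v i ω‖ ^ 2 ∂μ := by
        refine integral_mono (integrable_finsetSum _ fun i _ => integrable_finsetSum _ fun i' _ =>
          (hinner i i').const_mul _) ((integrable_finsetSum _ fun i _ =>
          (hv2 i).integrable_norm_pow (by norm_num)).const_mul _) fun ω => ?_
        exact sum_mul_inner_le _ _
    _ = _ := integral_const_mul _ _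

end Consensus

section Disagreement

variable {m d : ℕ}

/-- Column sums equal to `1` preserve the mean under averaging; row sums equal to `1` let averaging
pass through the subtraction of the mean. -/
lemma sub_mean_step {A : Matrix (Fin m) (Fin m) ℝ} (hA : A ∈ doublyStochastic ℝ (Fin m))
    {y y' u : Fin m → Vec d} {a : ℝ} (h : ∀ j, y' j = ∑ i, A j i • y i - a • u j) (w : ℝ)
    (j : Fin m) :
    w • (y' j - mean y') =
      ∑ i, A j i • (w • (y i - mean y)) - (w * a) • (u j - mean u) := by
  have h1 : mean y' = mean y - a • mean u := by
    rw [← mean_sum_smul hA y, ← mean_sub_smul]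
    exact congrArg mean (funext h)
  have h2 : ∑ i, A j i • (w • (y i - mean y)) = w • (∑ i, A j i • y i - mean y) := by
    simp only [smul_comm (A j _) w, ← Finset.smul_sum, smul_sub, Finset.sum_sub_distrib,
      ← Finset.sum_smul, sum_row_of_mem_doublyStochastic hA, one_smul]
  rw [h1, h2, h j]
  module

variable {Ω : Type*} [mΩ : MeasurableSpace Ω] {μ : Measure Ω}

lemma memLp_mean {v : Fin m → Ω → Vec d} (hv : ∀ j, MemLp (v j) 2 μ) :
    MemLp (fun ω => mean fun j => v j ω) 2 μ :=
  (memLp_finsetSum Finset.univ fun j _ => hv j).const_smul ((m : ℝ)⁻¹)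

/-- The squared disagreements of a noisy averaging scheme with square-summable noise scale are
almost surely summable. No moment of the initial state is needed. -/
lemma ae_summable_sq_sub_mean [IsProbabilityMeasure μ] (hm : 0 < m) (𝒢 : Filtration ℕ mΩ)
    {A : ℕ → Ω → Matrix (Fin m) (Fin m) ℝ} (hA : ∀ k, Measurable (A k))
    (hst : ∀ k, ∀ᵐ ω ∂μ, A k ω ∈ doublyStochastic ℝ (Fin m))
    (hind : ∀ k, Indep (MeasurableSpace.comap (A k) inferInstance) (𝒢 k) μ)
    {ρ : ℝ} (hρ : ρ < 1) (hmix : ∀ k, mixingNorm μ (A k) ≤ ρ)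
    {y u : ℕ → Fin m → Ω → Vec d} (hy : ∀ k j, Measurable[𝒢 k] (y k j))
    (hu : ∀ k j, MemLp (u k j) 2 μ) {G : ℝ} (hG : ∀ k j, ∫ ω, ‖u k j ω‖ ^ 2 ∂μ ≤ G)
    {a : ℕ → ℝ} (ha : Summable fun k => a k ^ 2)
    (hrec : ∀ k, ∀ᵐ ω ∂μ, ∀ j, y (k + 1) j ω = ∑ i, A k ω j i • y k i ω - a k • u k j ω) :
    ∀ᵐ ω ∂μ, Summable fun k => ∑ j, ‖y k j ω - mean fun i => y k i ω‖ ^ 2 := by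
  -- A positive weight known at time `0` that makes the initial disagreement bounded. The recursion
  -- is linear in the disagreement, so the weight passes through it and is divided out pathwise at
  -- the end.
  set w : Ω → ℝ := fun ω => (1 + ∑ j, ‖y 0 j ω‖)⁻¹ with hw
  have hden : ∀ ω, 1 ≤ 1 + ∑ j, ‖y 0 j ω‖ := fun ω => by
    have : 0 ≤ ∑ j, ‖y 0 j ω‖ := Finset.sum_nonneg fun _ _ => norm_nonneg _
    linarith
  have hw0 : ∀ ω, 0 < w ω := fun ω => inv_pos.2 (by linarith [hden ω])
  have hw1 : ∀ ω, w ω ≤ 1 := fun ω => inv_le_one_of_one_le₀ (hden ω)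
  have hwm : Measurable[𝒢 0] w :=
    (Measurable.const_add (Finset.measurable_sum _ fun j _ => measurable_norm.comp (hy 0 j)) 1).inv
  set δ : ℕ → Fin m → Ω → Vec d := fun k j ω => w ω • (y k j ω - mean fun i => y k i ω) with hδ
  have hδm : ∀ k j, Measurable[𝒢 k] (δ k j) := by
    intro k j
    have hmean : Measurable[𝒢 k] fun ω => mean fun i => y k i ω :=
      (Finset.measurable_sum Finset.univ fun i _ => hy k i).const_smul ((m : ℝ)⁻¹)
    exact (hwm.mono (𝒢.mono k.zero_le) le_rfl).smul ((hy k j).sub hmean)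
  have hδ0 : ∀ k ω, ∑ j, δ k j ω = 0 := fun k ω => by
    simp only [hδ, ← Finset.smul_sum, sum_sub_mean hm, smul_zero]
  set e : ℕ → Fin m → Ω → Vec d := fun k j ω => u k j ω - mean fun i => u k i ω with he
  have he2 : ∀ k j, MemLp (e k j) 2 μ := fun k j => (hu k j).sub (memLp_mean (hu k))
  have hwe : ∀ k j, MemLp (fun ω => (w ω * a k) • e k j ω) 2 μ := by
    intro k j
    refine ((he2 k j).const_smul (a k)).mono
      (((hwm.mono (𝒢.le 0) le_rfl).mul_const (a k)).aestronglyMeasurable.smul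
        (he2 k j).aestronglyMeasurable) (Eventually.of_forall fun ω => ?_)
    rw [Pi.smul_apply, norm_smul, norm_smul, norm_mul, Real.norm_of_nonneg (hw0 ω).le]
    exact mul_le_mul_of_nonneg_right (mul_le_of_le_one_left (norm_nonneg _) (hw1 ω))
      (norm_nonneg _)
  have hδrec : ∀ k, ∀ᵐ ω ∂μ, ∀ j,
      δ (k + 1) j ω = ∑ i, A k ω j i • δ k i ω - (w ω * a k) • e k j ω := by
    intro k
    filter_upwards [hst k, hrec k] with ω h1 h2 j
    exact sub_mean_step h1 h2 (w ω) j
  have hδ2 : ∀ k j, MemLp (δ k j) 2 μ := by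
    intro k
    induction k with
    | zero =>
      intro j
      refine MemLp.of_bound ((hδm 0 j).mono (𝒢.le 0) le_rfl).aestronglyMeasurable 2
        (Eventually.of_forall fun ω => ?_)
      have h1 : ∀ i, ‖y 0 i ω‖ ≤ 1 + ∑ j, ‖y 0 j ω‖ := fun i => by
        have := Finset.single_le_sum (f := fun i => ‖y 0 i ω‖) (fun i _ => norm_nonneg _)
          (Finset.mem_univ i)
        linarith
      have h2 : ‖mean fun i => y 0 i ω‖ ≤ 1 + ∑ j, ‖y 0 j ω‖ := by
        rw [mean, norm_smul, norm_inv, Real.norm_natCast]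
        have h3 : (m : ℝ)⁻¹ ≤ 1 := inv_le_one_of_one_le₀ (by exact_mod_cast hm)
        have h4 := norm_sum_le Finset.univ fun i => y 0 i ω
        have h5 := mul_le_mul h3 h4 (norm_nonneg _) zero_le_one
        linarith
      have h6 := norm_sub_le (y 0 j ω) (mean fun i => y 0 i ω)
      simp only [hδ]
      rw [norm_smul, Real.norm_of_nonneg (hw0 ω).le, hw, inv_mul_le_iff₀ (by linarith [hden ω])]
      linarith [h1 j]
    | succ k ih =>
      intro j
      have h1 : ∀ i, MemLp (fun ω => A k ω j i • δ k i ω) 2 μ := by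
        intro i
        refine (ih i).mono (((measurable_entry j i).comp (hA k)).smul
          ((hδm k i).mono (𝒢.le k) le_rfl)).aestronglyMeasurable ?_
        filter_upwards [hst k] with ω hω
        rw [norm_smul, Real.norm_of_nonneg (nonneg_of_mem_doublyStochastic hω)]
        exact mul_le_of_le_one_left (norm_nonneg _) (le_one_of_mem_doublyStochastic hω)
      refine ((memLp_finsetSum Finset.univ fun i _ => h1 i).sub (hwe k j)).ae_eq ?_
      filter_upwards [hδrec k] with ω hω
      rw [hω j]
      rfl
  set V : ℕ → ℝ := fun k => ∫ ω, ∑ j, ‖δ k j ω‖ ^ 2 ∂μ with hV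
  have hsqint : ∀ {v : Ω → Vec d}, MemLp v 2 μ → Integrable (fun ω => ‖v ω‖ ^ 2) μ := fun hv =>
    hv.integrable_norm_pow (by norm_num)
  have hVint : ∀ k, Integrable (fun ω => ∑ j, ‖δ k j ω‖ ^ 2) μ := fun k =>
    integrable_finsetSum _ fun j _ => hsqint (hδ2 k j)
  have hρ0 : 0 ≤ ρ := le_trans (norm_nonneg _) (hmix 0)
  -- Splitting off the noise multiplies the contraction factor by `1 + η`; with this choice `(1 + η)
  -- ρ = ρ (3 - ρ) / 2 < 1`.
  set η := (1 - ρ) / 2 with hη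
  have hη0 : 0 < η := by rw [hη]; linarith
  have hr : (1 + η) * ρ < 1 := by rw [hη]; nlinarith
  have hstep : ∀ k, V (k + 1) ≤ (1 + η) * ρ * V k + (1 + η⁻¹) * (m * G) * a k ^ 2 := by
    intro k
    have hAint : ∀ j, MemLp (fun ω => ∑ i, A k ω j i • δ k i ω) 2 μ := by
      intro j
      refine ((hδ2 (k + 1) j).add (hwe k j)).ae_eq ?_
      filter_upwards [hδrec k] with ω hω
      rw [Pi.add_apply, hω j, sub_add_cancel]
    have hbound : ∀ᵐ ω ∂μ, ∑ j, ‖δ (k + 1) j ω‖ ^ 2 ≤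
        (1 + η) * ∑ j, ‖∑ i, A k ω j i • δ k i ω‖ ^ 2
          + (1 + η⁻¹) * a k ^ 2 * ∑ j, ‖u k j ω‖ ^ 2 := by
      filter_upwards [hδrec k] with ω hω
      have h1 : ∀ j, ‖δ (k + 1) j ω‖ ^ 2 ≤ (1 + η) * ‖∑ i, A k ω j i • δ k i ω‖ ^ 2
          + (1 + η⁻¹) * a k ^ 2 * ‖e k j ω‖ ^ 2 := by
        intro j
        rw [hω j, sub_eq_add_neg]
        refine (norm_add_sq_le_mul _ _ hη0).trans ?_
        rw [norm_neg, norm_smul, mul_pow, Real.norm_eq_abs, sq_abs, mul_pow, mul_assoc (1 + η⁻¹)]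
        have : w ω ^ 2 ≤ 1 := pow_le_one₀ (hw0 ω).le (hw1 ω)
        have h7 : w ω ^ 2 * a k ^ 2 ≤ a k ^ 2 := mul_le_of_le_one_left (sq_nonneg _) this
        gcongr
      refine (Finset.sum_le_sum fun j _ => h1 j).trans ?_
      rw [Finset.sum_add_distrib, ← Finset.mul_sum, ← Finset.mul_sum]
      have := sum_norm_sub_mean_sq_le hm fun j => u k j ω
      gcongr
    have hu2 : Integrable (fun ω => ∑ j, ‖u k j ω‖ ^ 2) μ :=
      integrable_finsetSum _ fun j _ => hsqint (hu k j)
    have hA2 : Integrable (fun ω => ∑ j, ‖∑ i, A k ω j i • δ k i ω‖ ^ 2) μ :=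
      integrable_finsetSum _ fun j _ => hsqint (hAint j)
    have h2 := integral_mono_ae (hVint (k + 1))
      ((hA2.const_mul (1 + η)).add (hu2.const_mul ((1 + η⁻¹) * a k ^ 2))) hbound
    have h3 : ∫ ω, ∑ j, ‖u k j ω‖ ^ 2 ∂μ ≤ m * G := by
      rw [integral_finsetSum _ fun j _ => hsqint (hu k j)]
      refine (Finset.sum_le_sum fun j _ => hG k j).trans ?_
      simp
    have h4 := integral_sum_norm_sum_smul_sq_le (hA k) (hst k) (hind k) (hδm k) (hδ2 k) (hδ0 k)
    have h5 : ∫ ω, ∑ j, ‖∑ i, A k ω j i • δ k i ω‖ ^ 2 ∂μ ≤ ρ * V k :=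
      h4.trans (mul_le_mul_of_nonneg_right (hmix k)
        (integral_nonneg fun ω => Finset.sum_nonneg fun _ _ => sq_nonneg _))
    refine h2.trans ?_
    simp only [Pi.add_apply]
    rw [integral_add (hA2.const_mul (1 + η)) (hu2.const_mul ((1 + η⁻¹) * a k ^ 2)),
      integral_const_mul, integral_const_mul]
    calc _ ≤ (1 + η) * (ρ * V k) + (1 + η⁻¹) * a k ^ 2 * (m * G) := by gcongr
      _ = _ := by ring
  have hG0 : 0 ≤ G := (integral_nonneg fun ω => sq_nonneg _).trans (hG 0 ⟨0, hm⟩)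
  have hVsum : Summable V := by
    refine summable_of_le_mul_add hr (fun k => integral_nonneg fun ω =>
      Finset.sum_nonneg fun _ _ => sq_nonneg _) (ha.mul_left ((1 + η⁻¹) * (m * G)))
      (fun k => ?_) hstep
    positivity
  filter_upwards [ae_summable_of_summable_integral
    (fun k ω => Finset.sum_nonneg fun j _ => sq_nonneg ‖δ k j ω‖) hVint hVsum] with ω hω
  have h1 : ∀ k, ∑ j, ‖y k j ω - mean fun i => y k i ω‖ ^ 2 =
      (w ω ^ 2)⁻¹ * ∑ j, ‖δ k j ω‖ ^ 2 := by
    intro k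
    simp only [hδ, norm_smul, mul_pow, Real.norm_of_nonneg (hw0 ω).le, ← Finset.mul_sum]
    rw [inv_mul_cancel_left₀ (pow_pos (hw0 ω) 2).ne']
  simp only [h1]
  exact hω.mul_left _

end Disagreement

/-! ### Deterministic convergence arguments -/

/-- The pathwise form of the Robbins–Siegmund theorem. -/
lemma exists_tendsto_of_le_sub_add {L d e n : ℕ → ℝ} (hL : ∀ k, 0 ≤ L k) (hd : ∀ k, 0 ≤ d k)
    (he : Summable e) (hn : ∃ l, Tendsto (fun N => ∑ k ∈ Finset.range N, n k) atTop (𝓝 l))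
    (h : ∀ k, L (k + 1) ≤ L k - d k + e k + n k) :
    (∃ l, Tendsto L atTop (𝓝 l)) ∧ Summable d := by
  obtain ⟨ln, hln⟩ := hn
  -- Compensating `L` by the accumulated terms makes it antitone; it is bounded below because the
  -- sums of `e` and `n` converge.
  set T : ℕ → ℝ := fun N => L N + ∑ k ∈ Finset.range N, d k - ∑ k ∈ Finset.range N, e k
    - ∑ k ∈ Finset.range N, n k with hT
  have hanti : Antitone T := by
    refine antitone_nat_of_succ_le fun N => ?_
    simp only [hT, Finset.sum_range_succ]
    linarith [h N]
  have hen : Tendsto (fun N => ∑ k ∈ Finset.range N, e k + ∑ k ∈ Finset.range N, n k) atTop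
      (𝓝 (∑' k, e k + ln)) := he.hasSum.tendsto_sum_nat.add hln
  have hd0 : ∀ N, 0 ≤ ∑ k ∈ Finset.range N, d k := fun N => Finset.sum_nonneg fun k _ => hd k
  obtain ⟨M, hM⟩ := hen.bddAbove_range
  have hbelow : BddBelow (Set.range T) := by
    refine ⟨-M, ?_⟩
    rintro _ ⟨N, rfl⟩
    have := hM ⟨N, rfl⟩
    simp only at this
    simp only [hT]
    linarith [hL N, hd0 N]
  have hTlim := tendsto_atTop_ciInf hanti hbelow
  have hLd : Tendsto (fun N => L N + ∑ k ∈ Finset.range N, d k) atTop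
      (𝓝 ((⨅ N, T N) + (∑' k, e k + ln))) := by
    refine (hTlim.add hen).congr fun N => ?_
    simp only [hT]
    ring
  obtain ⟨M', hM'⟩ := hLd.bddAbove_range
  have hdsum : Summable d := by
    refine summable_of_sum_range_le (c := M') hd fun N => ?_
    have := hM' ⟨N, rfl⟩
    simp only at this
    linarith [hL N]
  refine ⟨⟨_, (hLd.sub hdsum.hasSum.tendsto_sum_nat).congr fun N => ?_⟩, hdsum⟩
  ring

/-- Weighted Cesàro convergence: with divergent total weight, the deviations from the limit sum to a
little-o of that weight. -/
lemma tendsto_weighted_mean {E : Type*} [NormedAddCommGroup E] [NormedSpace ℝ E] {a : ℕ → ℝ}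
    (ha : ∀ k, 0 ≤ a k)
    (hs : Tendsto (fun n => ∑ k ∈ Finset.range n, a k) atTop atTop) {v : ℕ → E} {l : E}
    (hv : Tendsto v atTop (𝓝 l)) :
    Tendsto (fun n => (∑ k ∈ Finset.range n, a k)⁻¹ • ∑ k ∈ Finset.range n, a k • v k) atTop
      (𝓝 l) := by
  have h1 : (fun k => a k • (v k - l)) =o[atTop] a := by
    have h2 : (fun k => v k - l) =o[atTop] fun _ => (1 : ℝ) := by
      rw [Asymptotics.isLittleO_one_iff]
      simpa using hv.sub_const l
    have := (Asymptotics.isBigO_refl a atTop).smul_isLittleO h2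
    simpa using this
  have h3 := (h1.sum_range ha hs).norm_right.tendsto_inv_smul_nhds_zero
  have h4 : Tendsto (fun n => (∑ k ∈ Finset.range n, a k)⁻¹ •
      ∑ k ∈ Finset.range n, a k • (v k - l)) atTop (𝓝 0) := by
    refine h3.congr fun n => ?_
    rw [Real.norm_of_nonneg (Finset.sum_nonneg fun k _ => ha k)]
  have h5 := h4.add_const l
  rw [zero_add] at h5
  refine h5.congr' ?_
  filter_upwards [hs.eventually_gt_atTop 0] with n hn
  simp only [smul_sub, Finset.sum_sub_distrib, ← Finset.sum_smul]
  rw [smul_smul, inv_mul_cancel₀ hn.ne', one_smul, sub_add_cancel]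

/-- Convergence of a dual averaging path to the unique minimizer from the perturbed descent of the
Fenchel coupling. -/
lemma tendsto_mirrorMap_of_descent {d : ℕ} {X : Set (Vec d)} (hcl : IsClosed X) (hX : Convex ℝ X)
    {p : Vec d} (hp : p ∈ X) {f : Vec d → ℝ} (hf : ContinuousOn f X)
    (hmin : ∀ x ∈ X, f p ≤ f x) (huniq : ∀ x ∈ X, f x = f p → x = p)
    {η : ℝ} (hη : 0 < η) (hloc : ∀ y : Vec d, ‖mirrorMap euclideanReg X y - p‖ < η →
      coupling X p y = ‖mirrorMap euclideanReg X y - p‖ ^ 2 / 2)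
    {y : ℕ → Vec d} {a e n : ℕ → ℝ} (ha0 : ∀ k, 0 ≤ a k) (ha : ¬ Summable a)
    (he0 : ∀ k, 0 ≤ e k) (he : Summable e)
    (hn : ∃ l, Tendsto (fun N => ∑ k ∈ Finset.range N, n k) atTop (𝓝 l))
    (hstep : ∀ k, coupling X p (y (k + 1)) ≤ coupling X p (y k)
      - a k * (f (mirrorMap euclideanReg X (y k)) - f p) + e k + (1 + coupling X p (y k)) * n k) :
    Tendsto (fun k => mirrorMap euclideanReg X (y k)) atTop (𝓝 p) := by
  have hne : X.Nonempty := ⟨p, hp⟩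
  set x : ℕ → Vec d := fun k => mirrorMap euclideanReg X (y k) with hx
  set R : ℕ → ℝ := fun k => coupling X p (y k) with hR
  have hxX : ∀ k, x k ∈ X := fun k => mirrorMap_mem hne hcl hX _
  have hR0 : ∀ k, 0 ≤ R k := fun k => coupling_nonneg hne hcl hX hp _
  have hRx : ∀ k, ‖x k - p‖ ^ 2 / 2 ≤ R k := fun k => half_norm_sq_le_coupling hne hcl hX hp _
  have hgap : ∀ k, 0 ≤ a k * (f (x k) - f p) := fun k =>
    mul_nonneg (ha0 k) (sub_nonneg.2 (hmin _ (hxX k)))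
  -- The noise carries the factor `1 + R k`, which is not yet known to be bounded. From `log (1 +
  -- R') ≤ log (1 + R) + (R' - R) / (1 + R)` it becomes additive, and dividing `e` by `1 + R` only
  -- helps.
  obtain ⟨⟨l, hl⟩, hdsum⟩ := exists_tendsto_of_le_sub_add (L := fun k => Real.log (1 + R k))
    (d := fun k => a k * (f (x k) - f p) / (1 + R k)) (e := e) (n := n)
    (fun k => Real.log_nonneg (by linarith [hR0 k]))
    (fun k => div_nonneg (hgap k) (by linarith [hR0 k])) he hn (by
      intro k
      have hpos : 0 < 1 + R k := by linarith [hR0 k]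
      have hpos' : 0 < 1 + R (k + 1) := by linarith [hR0 (k + 1)]
      have h1 := Real.log_le_sub_one_of_pos (div_pos hpos' hpos)
      rw [Real.log_div hpos'.ne' hpos.ne'] at h1
      have h2 : (1 + R (k + 1)) / (1 + R k) - 1 ≤
          -(a k * (f (x k) - f p) / (1 + R k)) + e k + n k := by
        rw [div_sub_one hpos.ne', div_le_iff₀ hpos]
        have h3 : (-(a k * (f (x k) - f p) / (1 + R k)) + e k + n k) * (1 + R k) =
            -(a k * (f (x k) - f p)) + e k * (1 + R k) + (1 + R k) * n k := by
          field_simp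
        have h4 := hstep k
        have h5 : 0 ≤ e k * R k := mul_nonneg (he0 k) (hR0 k)
        rw [h3]
        linarith
      linarith)
  have hRlim : Tendsto R atTop (𝓝 (Real.exp l - 1)) := by
    have := ((Real.continuous_exp.tendsto l).comp hl).sub_const 1
    refine this.congr fun k => ?_
    simp only [Function.comp]
    rw [Real.exp_log (by linarith [hR0 k])]
    ring
  set r := Real.exp l - 1 with hr
  have hr0 : 0 ≤ r := ge_of_tendsto' hRlim hR0
  have hrzero : r = 0 := by
    by_contra hne0
    have hrpos : 0 < r := lt_of_le_of_ne hr0 (Ne.symm hne0)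
    obtain ⟨M, hM⟩ := hRlim.bddAbove_range
    have hM' : ∀ k, R k ≤ M := fun k => hM ⟨k, rfl⟩
    have hM0 : 0 ≤ M := (hR0 0).trans (hM' 0)
    -- Within `θ` of `p` the coupling would be half the squared distance, hence below `r / 2`,
    -- although it tends to `r`. So the iterates eventually stay in the compact set `S`, whose outer
    -- radius comes from `‖x - p‖² / 2 ≤ R ≤ M`.
    set θ := min η (Real.sqrt r) with hθ
    have hθ0 : 0 < θ := lt_min hη (Real.sqrt_pos.2 hrpos)
    set S := X ∩ ({x | θ ≤ ‖x - p‖} ∩ {x | ‖x - p‖ ≤ Real.sqrt (2 * M)}) with hS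
    have hev : ∀ᶠ k in atTop, x k ∈ S := by
      filter_upwards [hRlim.eventually_const_lt (show r / 2 < r by linarith)] with k hk
      refine ⟨hxX k, ?_, ?_⟩
      · by_contra hge
        have hlt : ‖x k - p‖ < θ := not_le.1 hge
        have h1 := hloc (y k) (hlt.trans_le (min_le_left _ _))
        have h2 : ‖x k - p‖ < Real.sqrt r := hlt.trans_le (min_le_right _ _)
        have h3 : ‖x k - p‖ ^ 2 < r := by
          have := pow_lt_pow_left₀ h2 (norm_nonneg _) two_ne_zero
          rwa [Real.sq_sqrt hr0] at this
        have h4 : R k = ‖x k - p‖ ^ 2 / 2 := h1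
        linarith
      · refine Real.le_sqrt_of_sq_le ?_
        linarith [hRx k, hM' k]
    have hSc : IsCompact S := by
      refine (isCompact_closedBall p (Real.sqrt (2 * M))).of_isClosed_subset ?_ ?_
      · exact hcl.inter ((isClosed_le continuous_const (by fun_prop)).inter
          (isClosed_le (by fun_prop) continuous_const))
      · intro z hz
        rw [Metric.mem_closedBall, dist_eq_norm]
        exact hz.2.2
    obtain ⟨k₀, hk₀⟩ := hev.exists
    obtain ⟨z, hzS, hz⟩ := hSc.exists_isMinOn ⟨_, hk₀⟩ (hf.mono Set.inter_subset_left)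
    have hzp : f p < f z := by
      refine lt_of_le_of_ne (hmin z hzS.1) fun heq => ?_
      have := huniq z hzS.1 heq.symm
      have h1 : θ ≤ ‖z - p‖ := hzS.2.1
      rw [this, sub_self, norm_zero] at h1
      linarith
    -- On `S` the objective gap is bounded away from zero, so summability of the weighted gaps would
    -- make `a` summable.
    refine ha (summable_of_isBigO_nat hdsum (Asymptotics.IsBigO.of_bound
      ((1 + M) / (f z - f p)) ?_))
    filter_upwards [hev] with k hk
    have h1 : f z ≤ f (x k) := hz hk
    have hfz : 0 < f z - f p := by linarith
    have hpos : 0 < 1 + R k := by linarith [hR0 k]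
    rw [Real.norm_of_nonneg (ha0 k), Real.norm_of_nonneg (div_nonneg (hgap k) hpos.le),
      div_mul_div_comm, le_div_iff₀ (by positivity)]
    calc a k * ((f z - f p) * (1 + R k)) ≤ a k * ((f (x k) - f p) * (1 + M)) := by
          have h2 := hM' k
          have h3 := ha0 k
          gcongr
          linarith
      _ = _ := by ring
  rw [hrzero] at hRlim
  rw [tendsto_iff_norm_sub_tendsto_zero]
  have hsq : Tendsto (fun k => ‖x k - p‖ ^ 2) atTop (𝓝 0) := by
    refine squeeze_zero (fun k => sq_nonneg _) (g := fun k => 2 * R k) (fun k => ?_) ?_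
    · linarith [hRx k]
    · simpa using hRlim.const_mul 2
  have := (Real.continuous_sqrt.tendsto 0).comp hsq
  rw [Real.sqrt_zero] at this
  refine this.congr fun k => ?_
  simp only [Function.comp]
  exact Real.sqrt_sq (norm_nonneg _)

/-! ### Distributed dual averaging with a bounded-variance oracle -/

section Oracle

variable {m d : ℕ}

/-- One step of distributed dual averaging as a perturbed descent step of the Fenchel coupling. -/
lemma coupling_mean_step_le {X : Set (Vec d)} (hcl : IsClosed X) (hX : Convex ℝ X) (hm : 0 < m)
    {p : Vec d} (hp : p ∈ X) {f : Fin m → Vec d → ℝ} {K : ℝ} (hK : 0 ≤ K)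
    (hlip : ∀ j, ∀ x ∈ X, ∀ x' ∈ X, |f j x - f j x'| ≤ K * ‖x - x'‖)
    (y g G : Fin m → Vec d) {a : ℝ} (ha : 0 ≤ a) (hG : ∀ j, ‖G j‖ ≤ K)
    (hsub : ∀ j, f j (mirrorMap euclideanReg X (y j)) - f j p ≤
      ⟪G j, mirrorMap euclideanReg X (y j) - p⟫) :
    coupling X p (mean y - a • mean g) ≤ coupling X p (mean y)
      - (m : ℝ)⁻¹ * a * (∑ j, f j (mirrorMap euclideanReg X (mean y)) - ∑ j, f j p)
      + (m : ℝ)⁻¹ * ∑ j, (K * (a ^ 2 + ‖y j - mean y‖ ^ 2) + a ^ 2 * ‖g j‖ ^ 2)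
      + (1 + coupling X p (mean y)) * -((m : ℝ)⁻¹ * ∑ j, a * ⟪g j - G j,
          (1 + coupling X p (mean y))⁻¹ • (mirrorMap euclideanReg X (mean y) - p)⟫) := by
  have hne : X.Nonempty := ⟨p, hp⟩
  have hm' : (0 : ℝ) < m := by positivity
  set x := mirrorMap euclideanReg X (mean y) with hx
  set R := coupling X p (mean y) with hR
  have hR0 : 0 < 1 + R := by linarith [coupling_nonneg hne hcl hX hp (mean y)]
  have h1 := coupling_add_le hne hcl hX p (mean y) (-(a • mean g))
  rw [← sub_eq_add_neg, norm_neg, norm_smul, mul_pow, Real.norm_eq_abs, sq_abs, inner_neg_left,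
    inner_smul_left, conj_trivial, ← hx, ← hR] at h1
  have h2 : ⟪mean g, x - p⟫ = (m : ℝ)⁻¹ * ∑ j, ⟪g j, x - p⟫ := by
    rw [mean, inner_smul_left, sum_inner, conj_trivial]
  have h3 : (1 + R) * -((m : ℝ)⁻¹ * ∑ j, a * ⟪g j - G j, (1 + R)⁻¹ • (x - p)⟫) =
      -((m : ℝ)⁻¹ * ∑ j, a * ⟪g j - G j, x - p⟫) := by
    simp only [inner_smul_right, Finset.mul_sum, mul_neg]
    rw [neg_inj]
    refine Finset.sum_congr rfl fun j _ => ?_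
    field_simp
  have h4 := norm_mean_sq_le hm g
  -- `G j` belongs to the agent's own point `xj`. Moving both the function value and the test
  -- direction to `x` costs `2 K a ‖y j - mean y‖`, which is at most `K (a² + ‖y j - mean y‖²)`.
  have h5 : ∀ j, a * (f j x - f j p) - K * (a ^ 2 + ‖y j - mean y‖ ^ 2) ≤
      a * ⟪G j, x - p⟫ := by
    intro j
    set xj := mirrorMap euclideanReg X (y j) with hxj
    have hd : ‖x - xj‖ ≤ ‖y j - mean y‖ := by
      rw [norm_sub_rev]; exact norm_mirrorMap_sub_le hne hcl hX _ _
    have h6 : ⟪G j, x - p⟫ = ⟪G j, xj - p⟫ + ⟪G j, x - xj⟫ := by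
      rw [← inner_add_right]; congr 1; abel
    have h7 : -(K * ‖x - xj‖) ≤ ⟪G j, x - xj⟫ := by
      have h8 := (neg_le_abs _).trans (abs_real_inner_le_norm (G j) (x - xj))
      have h9 := mul_le_mul_of_nonneg_right (hG j) (norm_nonneg (x - xj))
      linarith
    have h8 := (le_abs_self _).trans (hlip j x (mirrorMap_mem hne hcl hX _) xj
      (mirrorMap_mem hne hcl hX _))
    have h9 : f j x - f j p - 2 * K * ‖y j - mean y‖ ≤ ⟪G j, x - p⟫ := by
      have := mul_le_mul_of_nonneg_left hd hK
      linarith [hsub j]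
    have h10 := mul_le_mul_of_nonneg_left h9 ha
    have h11 := mul_nonneg hK (sq_nonneg (a - ‖y j - mean y‖))
    linarith
  have h6 : ∑ j, a * ⟪g j, x - p⟫ = ∑ j, a * ⟪g j - G j, x - p⟫ + ∑ j, a * ⟪G j, x - p⟫ := by
    rw [← Finset.sum_add_distrib]
    refine Finset.sum_congr rfl fun j _ => ?_
    rw [inner_sub_left]; ring
  have h7 := Finset.sum_le_sum fun j (_ : j ∈ Finset.univ) => h5 j
  rw [Finset.sum_sub_distrib, ← Finset.mul_sum, Finset.sum_sub_distrib] at h7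
  have h8 := mul_le_mul_of_nonneg_left h7 (inv_nonneg.2 hm'.le)
  have h9 := mul_le_mul_of_nonneg_left h4 (sq_nonneg a)
  have h10 : 0 ≤ a ^ 2 * ((m : ℝ)⁻¹ * ∑ j, ‖g j‖ ^ 2) := by positivity
  rw [h3, Finset.sum_add_distrib, ← Finset.mul_sum _ _ (a ^ 2)]
  rw [h2] at h1
  have h11 : a * ((m : ℝ)⁻¹ * ∑ j, ⟪g j, x - p⟫) = (m : ℝ)⁻¹ * ∑ j, a * ⟪g j, x - p⟫ := by
    rw [← Finset.mul_sum]; ring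
  rw [h11, h6] at h1
  have h12 : (m : ℝ)⁻¹ * a * (∑ j, f j x - ∑ j, f j p) =
      (m : ℝ)⁻¹ * (a * (∑ j, f j x - ∑ j, f j p)) := by ring
  rw [h12]
  simp only [mul_add, mul_sub] at *
  linarith

variable {Ω Ξ : Type*} [mΩ : MeasurableSpace Ω] [MeasurableSpace Ξ] {μ : Measure Ω}

/-- Convergence of the gradient noise tested against a bounded function of the current state. -/
lemma ae_exists_tendsto_sum_inner_noise [IsProbabilityMeasure μ] (𝒢 : Filtration ℕ mΩ)
    {ζ : ℕ → Ω → Ξ} (hζ : ∀ k, Measurable[𝒢 (k + 1)] (ζ k)) {ν : Measure Ξ}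
    (hlaw : ∀ k, μ.map (ζ k) = ν)
    (hind : ∀ k, Indep (MeasurableSpace.comap (ζ k) inferInstance) (𝒢 k) μ)
    {g : Vec d → Ξ → Vec d} (hg : Measurable fun q : Vec d × Ξ => g q.1 q.2) {Λ : Ξ → ℝ}
    (hΛ : MemLp Λ 2 ν) (hgΛ : ∀ y s, ‖g y s‖ ≤ Λ s)
    {G : Vec d → Vec d} (hG : ∀ y, ∫ s, g y s ∂ν = G y) (hGm : Measurable G)
    {y : ℕ → Fin m → Ω → Vec d} (hy : ∀ k i, Measurable[𝒢 k] (y k i)) (j : Fin m)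
    {Y : (Fin m → Vec d) → Vec d} (hY : Measurable Y) (hY1 : ∀ v, ‖Y v‖ ≤ 1)
    {a : ℕ → ℝ} (ha : Summable fun k => a k ^ 2) :
    ∀ᵐ ω ∂μ, ∃ l : ℝ, Tendsto (fun n => ∑ k ∈ Finset.range n,
      a k * ⟪g (y k j ω) (ζ k ω) - G (y k j ω), Y fun i => y k i ω⟫) atTop (𝓝 l) := by
  have hζ' : ∀ k, Measurable (ζ k) := fun k => (hζ k).mono (𝒢.le _) le_rfl
  have hνp : IsProbabilityMeasure ν := by
    rw [← hlaw 0]; exact Measure.isProbabilityMeasure_map (hζ' 0).aemeasurable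
  have hgy : ∀ y, Measurable (g y) := fun y => hg.comp (measurable_const.prodMk measurable_id)
  have hgint : ∀ y, Integrable (g y) ν := fun y =>
    (hΛ.integrable one_le_two).mono' (hgy y).aestronglyMeasurable (Eventually.of_forall (hgΛ y))
  set ℓ := ∫ s, Λ s ∂ν with hℓ
  have hGℓ : ∀ y, ‖G y‖ ≤ ℓ := fun y => by
    rw [← hG y]
    exact norm_integral_le_of_norm_le (hΛ.integrable one_le_two) (Eventually.of_forall (hgΛ y))
  set h : ℕ → (Fin m → Vec d) × Ξ → ℝ := fun k q =>
    a k * ⟪g (q.1 j) q.2 - G (q.1 j), Y q.1⟫ with hh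
  have hcoord : Measurable fun q : (Fin m → Vec d) × Ξ => q.1 j :=
    (measurable_pi_apply j).comp measurable_fst
  have hhm : ∀ k, Measurable (h k) := fun k =>
    measurable_const.mul (((hg.comp (hcoord.prodMk measurable_snd)).sub
      (hGm.comp hcoord)).inner (hY.comp measurable_fst))
  have hhb : ∀ k q, |h k q| ≤ |a k| * (Λ q.2 + ℓ) := by
    intro k q
    rw [hh, abs_mul]
    refine mul_le_mul_of_nonneg_left ?_ (abs_nonneg _)
    refine (abs_real_inner_le_norm _ _).trans ?_
    refine (mul_le_of_le_one_right (norm_nonneg _) (hY1 _)).trans ?_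
    exact (norm_sub_le _ _).trans (add_le_add (hgΛ _ _) (hGℓ _))
  have hΛ' : MemLp (fun s => Λ s + ℓ) 2 ν := hΛ.add (memLp_const ℓ)
  have hΛω : ∀ k, MemLp (fun ω => Λ (ζ k ω) + ℓ) 2 μ := by
    intro k
    have h1 : MemLp (fun s => Λ s + ℓ) 2 (μ.map (ζ k)) := by rw [hlaw k]; exact hΛ'
    exact h1.comp_of_map (hζ' k).aemeasurable
  have hUm : ∀ k, Measurable[𝒢 k] fun ω i => y k i ω := fun k =>
    @measurable_pi_lambda Ω (Fin m) (fun _ => Vec d) (𝒢 k) _ _ fun i => hy k i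
  have hbd : ∀ k ω, |h k (fun i => y k i ω, ζ k ω)| ≤ |a k| * (Λ (ζ k ω) + ℓ) := fun k ω =>
    hhb k _
  have hL2 : ∀ k, MemLp (fun ω => h k (fun i => y k i ω, ζ k ω)) 2 μ := by
    intro k
    refine ((hΛω k).const_mul |a k|).mono' ((hhm k).comp
      (((hUm k).mono (𝒢.le k) le_rfl).prodMk (hζ' k))).aestronglyMeasurable
      (Eventually.of_forall fun ω => hbd k ω)
  have hzero : ∀ k u, ∫ s, h k (u, s) ∂(μ.map (ζ k)) = 0 := by
    intro k u
    rw [hlaw k]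
    simp only [hh]
    rw [integral_const_mul]
    have h1 : ∀ s, ⟪g (u j) s - G (u j), Y u⟫ = ⟪Y u, g (u j) s - G (u j)⟫ := fun s =>
      real_inner_comm _ _
    have h2 : ∫ s, (g (u j) s - G (u j)) ∂ν = 0 := by
      rw [integral_sub (hgint _) (integrable_const _), hG]
      simp
    have h3 : Integrable (fun s => g (u j) s - G (u j)) ν := (hgint _).sub (integrable_const _)
    simp only [h1]
    rw [integral_inner h3, h2, inner_zero_right, mul_zero]
  have hsum : Summable fun k => ∫ ω, (h k (fun i => y k i ω, ζ k ω)) ^ 2 ∂μ := by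
    refine Summable.of_nonneg_of_le (fun k => integral_nonneg fun ω => sq_nonneg _)
      (fun k => ?_) (ha.mul_right (∫ s, (Λ s + ℓ) ^ 2 ∂ν))
    have h1 : ∫ s, (Λ s + ℓ) ^ 2 ∂ν = ∫ ω, (Λ (ζ k ω) + ℓ) ^ 2 ∂μ := by
      rw [← hlaw k, integral_map (hζ' k).aemeasurable]
      rw [hlaw k]
      exact hΛ'.aestronglyMeasurable.pow 2
    rw [h1, ← integral_const_mul]
    refine integral_mono (hL2 k).integrable_sq ((hΛω k).integrable_sq.const_mul _) fun ω => ?_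
    calc h k (fun i => y k i ω, ζ k ω) ^ 2 = |h k (fun i => y k i ω, ζ k ω)| ^ 2 :=
          (sq_abs _).symm
      _ ≤ (|a k| * (Λ (ζ k ω) + ℓ)) ^ 2 := pow_le_pow_left₀ (abs_nonneg _) (hbd k ω) 2
      _ = a k ^ 2 * (Λ (ζ k ω) + ℓ) ^ 2 := by rw [mul_pow, sq_abs]
  exact ae_exists_tendsto_sum_fresh 𝒢 (U := fun k ω i => y k i ω) (h := h) hUm hζ hind hhm hzero
    hL2 hsum

end Oracle

section Convergence

variable {m d : ℕ}

lemma mirrorMap_eq_self {X : Set (Vec d)} (hcl : IsClosed X) (hX : Convex ℝ X) {p : Vec d}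
    (hp : p ∈ X) : mirrorMap euclideanReg X p = p := by
  have h1 := inner_mirrorMap_le ⟨p, hp⟩ hcl hX p hp
  rw [real_inner_self_eq_norm_sq] at h1
  have h2 : ‖p - mirrorMap euclideanReg X p‖ = 0 :=
    pow_eq_zero_iff two_ne_zero |>.1 (le_antisymm h1 (sq_nonneg _))
  exact (sub_eq_zero.1 (norm_eq_zero.1 h2)).symm

lemma exists_tendsto_of_tendsto_inner {v : ℕ → Vec d}
    (h : ∀ i, ∃ l : ℝ, Tendsto (fun n => ⟪v n, EuclideanSpace.single i (1 : ℝ)⟫) atTop (𝓝 l)) :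
    ∃ l : Vec d, Tendsto v atTop (𝓝 l) := by
  choose l hl using h
  have h1 : ∀ n i, ⟪v n, EuclideanSpace.single i (1 : ℝ)⟫ = v n i := fun n i => by
    simp [EuclideanSpace.inner_single_right]
  simp only [h1] at hl
  refine ⟨WithLp.toLp 2 l, ?_⟩
  exact ((PiLp.continuous_toLp 2 (fun _ : Fin d => ℝ)).tendsto l).comp (tendsto_pi_nhds.2 hl)

/-- `‖x - p‖ ≤ 1 + ‖x - p‖² / 2 ≤ 1 + R`. This replaces boundedness of `X` in the noise estimate. -/
lemma norm_inv_smul_sub_le_one {X : Set (Vec d)} (hcl : IsClosed X) (hX : Convex ℝ X) {p : Vec d}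
    (hp : p ∈ X) (y : Vec d) :
    ‖(1 + coupling X p y)⁻¹ • (mirrorMap euclideanReg X y - p)‖ ≤ 1 := by
  have h0 := coupling_nonneg ⟨p, hp⟩ hcl hX hp y
  have h1 := half_norm_sq_le_coupling ⟨p, hp⟩ hcl hX hp y
  rw [norm_smul, norm_inv, Real.norm_of_nonneg (by linarith), inv_mul_le_iff₀ (by linarith),
    mul_one]
  nlinarith [sq_nonneg (‖mirrorMap euclideanReg X y - p‖ - 1)]

variable {Ω : Type*} [mΩ : MeasurableSpace Ω] {μ : Measure Ω}
  {Ξ : Fin m → Type*} [∀ j, MeasurableSpace (Ξ j)]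

/-- Almost sure convergence of distributed dual averaging with a stochastic oracle: the averaged
primal iterate converges to the unique minimizer, and the averaged dual iterate normalized by the
sum of the step sizes converges to minus the mean gradient there. -/
theorem ae_tendsto_mirrorMap_mean [IsProbabilityMeasure μ] (hm : 0 < m) (𝒢 : Filtration ℕ mΩ)
    {X : Set (Vec d)} (hcl : IsClosed X) (hX : Convex ℝ X) {p : Vec d} (hp : p ∈ X)
    {η : ℝ} (hη : 0 < η) (hloc : ∀ y : Vec d, ‖mirrorMap euclideanReg X y - p‖ < η →
      coupling X p y = ‖mirrorMap euclideanReg X y - p‖ ^ 2 / 2)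
    {f : Fin m → Vec d → ℝ} (hlip : ∀ j, ∃ L : ℝ, 0 ≤ L ∧ ∀ x ∈ X, ∀ x' ∈ X,
      |f j x - f j x'| ≤ L * ‖x - x'‖)
    (hmin : ∀ x ∈ X, ∑ j, f j p ≤ ∑ j, f j x)
    (huniq : ∀ x ∈ X, ∑ j, f j x = ∑ j, f j p → x = p)
    {A : ℕ → Ω → Matrix (Fin m) (Fin m) ℝ} (hA : ∀ k, Measurable (A k))
    (hst : ∀ k, ∀ᵐ ω ∂μ, A k ω ∈ doublyStochastic ℝ (Fin m))
    (hAind : ∀ k, Indep (MeasurableSpace.comap (A k) inferInstance) (𝒢 k) μ)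
    {ρ : ℝ} (hρ : ρ < 1) (hmix : ∀ k, mixingNorm μ (A k) ≤ ρ)
    {ζ : (j : Fin m) → ℕ → Ω → Ξ j} (hζ : ∀ j k, Measurable[𝒢 (k + 1)] (ζ j k))
    {ν : (j : Fin m) → Measure (Ξ j)} (hlaw : ∀ j k, μ.map (ζ j k) = ν j)
    (hind : ∀ j k, Indep (MeasurableSpace.comap (ζ j k) inferInstance) (𝒢 k) μ)
    {g : (j : Fin m) → Vec d → Ξ j → Vec d}
    (hg : ∀ j, Measurable fun q : Vec d × Ξ j => g j q.1 q.2)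
    {Λ : (j : Fin m) → Ξ j → ℝ} (hΛ : ∀ j, MemLp (Λ j) 2 (ν j))
    (hgΛ : ∀ j y s, ‖g j y s‖ ≤ Λ j s)
    {G : Fin m → Vec d → Vec d} (hG : ∀ j y, ∫ s, g j y s ∂(ν j) = G j y)
    (hGlip : ∀ j, ∃ L : ℝ, 0 ≤ L ∧ ∀ y y', ‖G j y - G j y'‖ ≤
      L * ‖mirrorMap euclideanReg X y - mirrorMap euclideanReg X y'‖)
    (hsub : ∀ j y, f j (mirrorMap euclideanReg X y) - f j p ≤
      ⟪G j y, mirrorMap euclideanReg X y - p⟫)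
    {y : ℕ → Fin m → Ω → Vec d} (hy : ∀ k j, Measurable[𝒢 k] (y k j))
    {a : ℕ → ℝ} (ha0 : ∀ k, 0 ≤ a k) (ha : ¬ Summable a) (ha2 : Summable fun k => a k ^ 2)
    (hrec : ∀ k, ∀ᵐ ω ∂μ, ∀ j, y (k + 1) j ω =
      ∑ i, A k ω j i • y k i ω - a k • g j (y k j ω) (ζ j k ω)) :
    ∀ᵐ ω ∂μ,
      Tendsto (fun k => mirrorMap euclideanReg X (mean fun j => y k j ω)) atTop (𝓝 p) ∧
      Tendsto (fun k => (∑ t ∈ Finset.range k, a t)⁻¹ • mean fun j => y k j ω) atTop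
        (𝓝 (-mean fun j => G j p)) := by
  have hne : X.Nonempty := ⟨p, hp⟩
  have hζ' : ∀ j k, Measurable (ζ j k) := fun j k => (hζ j k).mono (𝒢.le _) le_rfl
  have hνp : ∀ j, IsProbabilityMeasure (ν j) := fun j => by
    rw [← hlaw j 0]; exact Measure.isProbabilityMeasure_map (hζ' j 0).aemeasurable
  choose LG hLG0 hLG using hGlip
  have hGm : ∀ j, Measurable (G j) := by
    intro j
    refine (LipschitzWith.of_dist_le_mul (K := (LG j).toNNReal) fun z w => ?_).continuous.measurable
    rw [dist_eq_norm, dist_eq_norm, Real.coe_toNNReal _ (hLG0 j)]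
    exact (hLG j z w).trans
      (mul_le_mul_of_nonneg_left (norm_mirrorMap_sub_le hne hcl hX z w) (hLG0 j))
  have hGb : ∀ j z, ‖G j z‖ ≤ ∫ s, Λ j s ∂(ν j) := fun j z => by
    rw [← hG j z]
    exact norm_integral_le_of_norm_le ((hΛ j).integrable one_le_two)
      (Eventually.of_forall (hgΛ j z))
  have hΛ0 : ∀ j s, 0 ≤ Λ j s := fun j s => (norm_nonneg _).trans (hgΛ j 0 s)
  choose Lf hLf0 hLf using hlip
  set K := ∑ j, (Lf j + ∫ s, Λ j s ∂(ν j)) with hK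
  have hint0 : ∀ j, 0 ≤ ∫ s, Λ j s ∂(ν j) := fun j => integral_nonneg (hΛ0 j)
  have hKj : ∀ j, Lf j + ∫ s, Λ j s ∂(ν j) ≤ K := fun j =>
    Finset.single_le_sum (f := fun j => Lf j + ∫ s, Λ j s ∂(ν j))
      (fun j _ => add_nonneg (hLf0 j) (hint0 j)) (Finset.mem_univ j)
  have hK0 : 0 ≤ K := Finset.sum_nonneg fun j _ => add_nonneg (hLf0 j) (hint0 j)
  have hKlip : ∀ j, ∀ x ∈ X, ∀ x' ∈ X, |f j x - f j x'| ≤ K * ‖x - x'‖ := fun j x hx x' hx' =>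
    (hLf j x hx x' hx').trans (mul_le_mul_of_nonneg_right
      (by linarith [hKj j, hint0 j]) (norm_nonneg _))
  have hKG : ∀ j z, ‖G j z‖ ≤ K := fun j z => (hGb j z).trans (by linarith [hKj j, hLf0 j])
  have hfc : ContinuousOn (fun x => ∑ j, f j x) X := by
    refine continuousOn_finsetSum _ fun j _ => ?_
    refine (LipschitzOnWith.of_dist_le_mul (K := K.toNNReal) fun x hx x' hx' => ?_).continuousOn
    rw [Real.dist_eq, dist_eq_norm, Real.coe_toNNReal _ hK0]
    exact hKlip j x hx x' hx'
  have hΛω : ∀ j k, MemLp (fun ω => Λ j (ζ j k ω)) 2 μ := by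
    intro j k
    have h1 : MemLp (Λ j) 2 (μ.map (ζ j k)) := by rw [hlaw j k]; exact hΛ j
    exact h1.comp_of_map (hζ' j k).aemeasurable
  have hΛsq : ∀ j k, ∫ ω, Λ j (ζ j k ω) ^ 2 ∂μ = ∫ s, Λ j s ^ 2 ∂(ν j) := by
    intro j k
    rw [← hlaw j k, integral_map (hζ' j k).aemeasurable]
    rw [hlaw j k]
    exact (hΛ j).aestronglyMeasurable.pow 2
  have hum : ∀ k j, Measurable fun ω => g j (y k j ω) (ζ j k ω) := fun k j =>
    (hg j).comp (((hy k j).mono (𝒢.le k) le_rfl).prodMk (hζ' j k))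
  have hu : ∀ k j, MemLp (fun ω => g j (y k j ω) (ζ j k ω)) 2 μ := fun k j =>
    (hΛω j k).mono' (hum k j).aestronglyMeasurable
      (Eventually.of_forall fun ω => hgΛ j _ _)
  have hu2 : ∀ k j, ∫ ω, ‖g j (y k j ω) (ζ j k ω)‖ ^ 2 ∂μ ≤ ∫ s, Λ j s ^ 2 ∂(ν j) := by
    intro k j
    rw [← hΛsq j k]
    exact integral_mono ((hu k j).integrable_norm_pow (by norm_num)) (hΛω j k).integrable_sq
      fun ω => pow_le_pow_left₀ (norm_nonneg _) (hgΛ j _ _) 2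
  have hcons := ae_summable_sq_sub_mean hm 𝒢 hA hst hAind hρ hmix hy hu
    (G := ∑ j, ∫ s, Λ j s ^ 2 ∂(ν j)) (fun k j => (hu2 k j).trans
      (Finset.single_le_sum (f := fun j => ∫ s, Λ j s ^ 2 ∂(ν j))
        (fun j _ => integral_nonneg fun s => sq_nonneg _) (Finset.mem_univ j))) ha2 hrec
  have hgsum : ∀ j, ∀ᵐ ω ∂μ, Summable fun k => a k ^ 2 * ‖g j (y k j ω) (ζ j k ω)‖ ^ 2 := by
    intro j
    have hint : ∀ k, Integrable (fun ω => ‖g j (y k j ω) (ζ j k ω)‖ ^ 2) μ := fun k =>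
      (hu k j).integrable_norm_pow (by norm_num)
    refine ae_summable_of_summable_integral (fun k ω => by positivity)
      (fun k => (hint k).const_mul _) ?_
    simp only [integral_const_mul]
    refine Summable.of_nonneg_of_le (fun k => mul_nonneg (sq_nonneg _)
      (integral_nonneg fun ω => sq_nonneg _)) (fun k => ?_)
      (ha2.mul_right (∫ s, Λ j s ^ 2 ∂(ν j)))
    exact mul_le_mul_of_nonneg_left (hu2 k j) (sq_nonneg _)
  have hmeanc : Continuous fun v : Fin m → Vec d => mean v := by unfold mean; fun_prop
  have hYm : Measurable fun v : Fin m → Vec d =>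
      (1 + coupling X p (mean v))⁻¹ • (mirrorMap euclideanReg X (mean v) - p) := by
    have h1 := (continuous_coupling hne hcl hX p).comp hmeanc
    have h2 := (continuous_mirrorMap hne hcl hX).comp hmeanc
    exact ((measurable_const.add h1.measurable).inv).smul (h2.measurable.sub measurable_const)
  have hnoise : ∀ j, ∀ᵐ ω ∂μ, ∃ l : ℝ, Tendsto (fun n => ∑ k ∈ Finset.range n,
      a k * ⟪g j (y k j ω) (ζ j k ω) - G j (y k j ω),
        (1 + coupling X p (mean fun i => y k i ω))⁻¹ •
          (mirrorMap euclideanReg X (mean fun i => y k i ω) - p)⟫) atTop (𝓝 l) := fun j =>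
    ae_exists_tendsto_sum_inner_noise 𝒢 (hζ j) (hlaw j) (hind j) (hg j) (hΛ j) (hgΛ j) (hG j)
      (hGm j) hy j hYm (fun v => norm_inv_smul_sub_le_one hcl hX hp _) ha2
  -- The same noise tested against basis vectors: its vector-valued sum converges, hence vanishes
  -- after division by the total step size.
  have hnoise' : ∀ j (i : Fin d), ∀ᵐ ω ∂μ, ∃ l : ℝ, Tendsto (fun n => ∑ k ∈ Finset.range n,
      a k * ⟪g j (y k j ω) (ζ j k ω) - G j (y k j ω), EuclideanSpace.single i (1 : ℝ)⟫)
      atTop (𝓝 l) := fun j i =>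
    ae_exists_tendsto_sum_inner_noise 𝒢 (hζ j) (hlaw j) (hind j) (hg j) (hΛ j) (hgΛ j) (hG j)
      (hGm j) hy j measurable_const (fun v => by simp) ha2
  have hs : Tendsto (fun n => ∑ k ∈ Finset.range n, a k) atTop atTop :=
    (not_summable_iff_tendsto_nat_atTop_of_nonneg ha0).1 ha
  have hm' : (0 : ℝ) < m := by positivity
  filter_upwards [hcons, ae_all_iff.2 hgsum, ae_all_iff.2 hnoise,
    ae_all_iff.2 fun j => ae_all_iff.2 (hnoise' j), ae_all_iff.2 hrec, ae_all_iff.2 hst]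
    with ω hc hgs hn hn' hr hstω
  have hmean : ∀ k, (mean fun j => y (k + 1) j ω) =
      (mean fun j => y k j ω) - a k • mean fun j => g j (y k j ω) (ζ j k ω) := by
    intro k
    rw [← mean_sum_smul (hstω k) fun j => y k j ω, ← mean_sub_smul]
    exact congrArg mean (funext (hr k))
  have hxlim : Tendsto (fun k => mirrorMap euclideanReg X (mean fun j => y k j ω)) atTop
      (𝓝 p) := by
    choose l hl using hn
    refine tendsto_mirrorMap_of_descent hcl hX hp hfc hmin huniq hη hloc
      (a := fun k => (m : ℝ)⁻¹ * a k)
      (e := fun k => (m : ℝ)⁻¹ * ∑ j, (K * (a k ^ 2 + ‖y k j ω - mean fun i => y k i ω‖ ^ 2)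
        + a k ^ 2 * ‖g j (y k j ω) (ζ j k ω)‖ ^ 2))
      (n := fun k => -((m : ℝ)⁻¹ * ∑ j, a k * ⟪g j (y k j ω) (ζ j k ω) - G j (y k j ω),
        (1 + coupling X p (mean fun i => y k i ω))⁻¹ •
          (mirrorMap euclideanReg X (mean fun i => y k i ω) - p)⟫))
      (fun k => mul_nonneg (inv_nonneg.2 hm'.le) (ha0 k)) ?_ (fun k => ?_) ?_
      ⟨-((m : ℝ)⁻¹ * ∑ j, l j), ?_⟩ fun k => ?_
    · rwa [summable_mul_left_iff (inv_ne_zero hm'.ne')]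
    · positivity
    · refine Summable.mul_left _ ?_
      have h1 : Summable fun k => ∑ j, ‖y k j ω - mean fun i => y k i ω‖ ^ 2 := hc
      have h2 : ∀ j, Summable fun k => ‖y k j ω - mean fun i => y k i ω‖ ^ 2 := fun j =>
        Summable.of_nonneg_of_le (fun k => sq_nonneg _)
          (fun k => Finset.single_le_sum (f := fun j => ‖y k j ω - mean fun i => y k i ω‖ ^ 2)
            (fun j _ => sq_nonneg _) (Finset.mem_univ j)) h1
      exact summable_sum fun j _ => ((ha2.add (h2 j)).mul_left K).add (hgs j)
    · have h1 := (tendsto_finsetSum Finset.univ fun j _ => hl j)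
      refine ((h1.const_mul (m : ℝ)⁻¹).neg).congr fun n => ?_
      rw [Finset.sum_neg_distrib, ← Finset.mul_sum, Finset.sum_comm]
    · rw [hmean k]
      exact coupling_mean_step_le hcl hX hm hp hK0 hKlip (fun j => y k j ω)
        (fun j => g j (y k j ω) (ζ j k ω)) (fun j => G j (y k j ω)) (ha0 k)
        (fun j => hKG j _) (fun j => hsub j _)
  refine ⟨hxlim, ?_⟩
  -- Unrolled recursion: initial state, noise and drift. After normalization only the weighted mean
  -- of the drift survives.
  have hsum : ∀ n, (mean fun j => y n j ω) = (mean fun j => y 0 j ω)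
      - (mean fun j => ∑ k ∈ Finset.range n, a k • (g j (y k j ω) (ζ j k ω) - G j (y k j ω)))
      - ∑ k ∈ Finset.range n, a k • mean fun j => G j (y k j ω) := by
    intro n
    induction n with
    | zero => simp [mean]
    | succ n ih =>
      rw [hmean n, ih, Finset.sum_range_succ]
      simp only [mean, Finset.sum_range_succ, Finset.sum_add_distrib, smul_sub,
        Finset.sum_sub_distrib, ← Finset.smul_sum, smul_add]
      rw [smul_comm (a n), smul_comm (a n) (m : ℝ)⁻¹ (∑ j, G j (y n j ω))]
      abel
  -- The drift is evaluated at the agents' own points, which follow the averaged one because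
  -- disagreement vanishes and the projection is nonexpansive.
  have hyj : ∀ j, Tendsto (fun k => mirrorMap euclideanReg X (y k j ω)) atTop (𝓝 p) := by
    intro j
    have h1 : Tendsto (fun k => ‖y k j ω - mean fun i => y k i ω‖) atTop (𝓝 0) := by
      have h2 := hc.tendsto_atTop_zero
      have h3 := (Real.continuous_sqrt.tendsto 0).comp h2
      rw [Real.sqrt_zero] at h3
      refine squeeze_zero (fun k => norm_nonneg _) (fun k => ?_) h3
      exact Real.le_sqrt_of_sq_le (Finset.single_le_sum
        (f := fun j => ‖y k j ω - mean fun i => y k i ω‖ ^ 2)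
        (fun j _ => sq_nonneg _) (Finset.mem_univ j))
    have h4 : Tendsto (fun k => mirrorMap euclideanReg X (y k j ω) -
        mirrorMap euclideanReg X (mean fun i => y k i ω)) atTop (𝓝 0) :=
      squeeze_zero_norm (fun k => norm_mirrorMap_sub_le hne hcl hX _ _) h1
    simpa using h4.add hxlim
  have hGlim : Tendsto (fun k => mean fun j => G j (y k j ω)) atTop (𝓝 (mean fun j => G j p)) := by
    unfold mean
    refine Tendsto.const_smul (tendsto_finsetSum _ fun j _ => ?_) _
    rw [tendsto_iff_norm_sub_tendsto_zero]
    have h1 : Tendsto (fun k => LG j * ‖mirrorMap euclideanReg X (y k j ω) - p‖) atTop (𝓝 0) := by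
      have h2 := (tendsto_iff_norm_sub_tendsto_zero.1 (hyj j)).const_mul (LG j)
      rwa [mul_zero] at h2
    refine squeeze_zero (fun k => norm_nonneg _) (fun k => ?_) h1
    -- Here `p` serves as a dual vector: it is its own projection, so `G j p` is the value of `G j`
    -- at the limit.
    have := hLG j (y k j ω) p
    rwa [mirrorMap_eq_self hcl hX hp] at this
  have hnlim : ∃ l : Vec d, Tendsto (fun n => mean fun j => ∑ k ∈ Finset.range n,
      a k • (g j (y k j ω) (ζ j k ω) - G j (y k j ω))) atTop (𝓝 l) := by
    have h1 : ∀ j, ∃ l : Vec d, Tendsto (fun n => ∑ k ∈ Finset.range n,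
        a k • (g j (y k j ω) (ζ j k ω) - G j (y k j ω))) atTop (𝓝 l) := fun j =>
      exists_tendsto_of_tendsto_inner fun i => by
        simpa only [sum_inner, real_inner_smul_left] using hn' j i
    choose l hl using h1
    exact ⟨mean l, (hmeanc.tendsto l).comp (tendsto_pi_nhds.2 hl)⟩
  obtain ⟨l, hl⟩ := hnlim
  have hinv := hs.inv_tendsto_atTop
  have h1 := hinv.smul (tendsto_const_nhds (x := mean fun j => y 0 j ω))
  have h2 := hinv.smul hl
  have h3 := tendsto_weighted_mean ha0 hs hGlim
  have h4 := (h1.sub h2).sub h3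
  simp only [zero_smul, sub_zero, zero_sub] at h4
  refine h4.congr fun n => ?_
  rw [hsum n, smul_sub, smul_sub]
  rfl

end Convergence

/-! ### The algorithm along its history -/

section Algorithm

variable {m d : ℕ} {Ξ : Fin m → Type*} [∀ j, MeasurableSpace (Ξ j)]

lemma measurable_grad_mirrorMap {X : Set (Vec d)} (hne : X.Nonempty) (hcl : IsClosed X)
    (hX : Convex ℝ X) {F : (j : Fin m) → Vec d → Ξ j → ℝ}
    {gradF : (j : Fin m) → Vec d → Ξ j → Vec d} {ν : (j : Fin m) → Measure (Ξ j)}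
    (hobj : ObjectiveAssumption X F gradF ν) (j : Fin m) :
    Measurable fun q : Vec d × Ξ j => gradF j (mirrorMap euclideanReg X q.1) q.2 := by
  have h1 : Measurable fun z : Vec d => (⟨mirrorMap euclideanReg X z, mirrorMap_mem hne hcl hX z⟩ :
      X) := (continuous_mirrorMap hne hcl hX).measurable.subtype_mk
  exact (hobj.measurable_grad j).comp ((h1.comp measurable_fst).prodMk measurable_snd)

/-- Trades a random index set for a fixed one, so measurability holds for every `ω`, although the
weights are nonnegative only almost surely. -/
lemma sum_neighbors_smul (A : Matrix (Fin m) (Fin m) ℝ) (j : Fin m) (z : Fin m → Vec d) :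
    ∑ i ∈ neighbors A j, A j i • z i = ∑ i, max (A j i) 0 • z i := by
  classical
  have h : neighbors A j = Finset.univ.filter fun i => 0 < A j i := by
    ext i; simp [neighbors]
  rw [h, Finset.sum_filter]
  refine Finset.sum_congr rfl fun i _ => ?_
  split_ifs with hi
  · rw [max_eq_left hi.le]
  · rw [max_eq_right (not_lt.1 hi), zero_smul]

lemma measurable_dual_step {Ω : Type*} {mΩ : MeasurableSpace Ω}
    {A : Ω → Matrix (Fin m) (Fin m) ℝ} (hA : Measurable A) {z : Fin m → Ω → Vec d}
    (hz : ∀ i, Measurable (z i)) {j : Fin m} {ζ : Ω → Ξ j} (hζ : Measurable ζ)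
    {h : Vec d → Ξ j → Vec d} (hh : Measurable fun q : Vec d × Ξ j => h q.1 q.2) (a : ℝ) :
    Measurable fun ω => ∑ i ∈ neighbors (A ω) j, A ω j i • z i ω - a • h (z j ω) (ζ ω) := by
  simp only [sum_neighbors_smul]
  refine (Finset.measurable_sum _ fun i _ => ?_).sub
    ((hh.comp ((hz j).prodMk hζ)).const_smul a)
  exact (((measurable_entry j i).comp hA).max measurable_const).smul (hz i)

variable {Ω : Type*} {z₀ : Fin m → Ω → Vec d} {ξ : (j : Fin m) → ℕ → Ω → Ξ j}
  {A : ℕ → Ω → Matrix (Fin m) (Fin m) ℝ}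

lemma history_mono : Monotone (history z₀ ξ A) := by
  intro k l hkl
  refine sup_le_sup (sup_le_sup le_rfl ?_) ?_
  · exact iSup_mono fun j => biSup_mono fun t ht => ⟨ht.1, ht.2.trans_le hkl⟩
  · exact biSup_mono fun t ht => ⟨ht.1, ht.2.trans_le hkl⟩

lemma measurable_init_history (k : ℕ) (j : Fin m) : Measurable[history z₀ ξ A k] (z₀ j) := by
  rw [measurable_iff_comap_le]
  exact (le_iSup (fun j => MeasurableSpace.comap (z₀ j) inferInstance) j).trans
    (le_sup_left.trans le_sup_left)

lemma measurable_sample_history {k t : ℕ} (ht : 1 ≤ t) (htk : t < k) (j : Fin m) :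
    Measurable[history z₀ ξ A k] (ξ j t) := by
  rw [measurable_iff_comap_le]
  refine le_trans ?_ (le_sup_right.trans le_sup_left)
  exact (le_iSup₂ (f := fun (t : ℕ) (_ : t ∈ Set.Ico 1 k) =>
    MeasurableSpace.comap (ξ j t) inferInstance) t ⟨ht, htk⟩).trans
    (le_iSup (fun j => ⨆ t ∈ Set.Ico 1 k, MeasurableSpace.comap (ξ j t) inferInstance) j)

lemma measurable_weight_history {k t : ℕ} (ht : 1 ≤ t) (htk : t < k) :
    Measurable[history z₀ ξ A k] (A t) := by
  rw [measurable_iff_comap_le]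
  refine le_trans ?_ le_sup_right
  exact le_iSup₂ (f := fun (t : ℕ) (_ : t ∈ Set.Ico 1 k) =>
    MeasurableSpace.comap (A t) inferInstance) t ⟨ht, htk⟩

/-- The dual variable of time `k` uses weights and samples up to time `k` inclusive, which is the
history with index `k + 1`. -/
lemma measurable_dual {X : Set (Vec d)} (hne : X.Nonempty) (hcl : IsClosed X)
    (hX : Convex ℝ X) {F : (j : Fin m) → Vec d → Ξ j → ℝ}
    {gradF : (j : Fin m) → Vec d → Ξ j → Vec d} {ν : (j : Fin m) → Measure (Ξ j)}
    (hobj : ObjectiveAssumption X F gradF ν) (step : ℕ → ℝ) (k : ℕ) (j : Fin m) :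
    Measurable[history z₀ ξ A (k + 1)] (dual X euclideanReg gradF step z₀ ξ A k j) := by
  induction k generalizing j with
  | zero => exact measurable_init_history 1 j
  | succ k ih =>
    exact measurable_dual_step
      (h := fun z s => gradF j (mirrorMap euclideanReg X z) s)
      (measurable_weight_history k.succ_pos (Nat.lt_succ_self _))
      (fun i => (ih i).mono (history_mono (Nat.le_succ _)) le_rfl)
      (measurable_sample_history k.succ_pos (Nat.lt_succ_self _) j)
      (measurable_grad_mirrorMap hne hcl hX hobj j) _

/-- The histories as a filtration; the `k`-th σ-algebra is `𝓕_{k+1}`. -/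
noncomputable def historyFiltration [mΩ : MeasurableSpace Ω] (hz : ∀ j, Measurable (z₀ j))
    (hξ : ∀ j, ∀ k ≥ 1, Measurable (ξ j k)) (hA : ∀ k ≥ 1, Measurable (A k)) :
    Filtration ℕ mΩ where
  seq k := history z₀ ξ A (k + 1)
  mono' _ _ hkl := history_mono (Nat.succ_le_succ hkl)
  le' k := by
    refine sup_le (sup_le (iSup_le fun j => (hz j).comap_le) ?_) ?_
    · exact iSup_le fun j => iSup₂_le fun t ht => (hξ j t ht.1).comap_le
    · exact iSup₂_le fun t ht => (hA t ht.1).comap_le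

lemma mixingNorm_eq_of_identDistrib [MeasurableSpace Ω] {μ : Measure Ω}
    {A A' : Ω → Matrix (Fin m) (Fin m) ℝ} (h : IdentDistrib A A' μ μ) :
    mixingNorm μ A = mixingNorm μ A' := by
  have h1 : ∀ i j, ∫ ω, disagreement (A ω) i j ∂μ = ∫ ω, disagreement (A' ω) i j ∂μ := fun i j =>
    (h.comp (measurable_disagreement i j)).integral_eq
  simp only [mixingNorm, h1]

end Algorithm

/-! ### Step sizes -/

lemma summable_step_sq {a α : ℝ} (hα : 2 / 3 < α) {step : ℕ → ℝ}
    (hstep : ∀ k ≥ 1, step k = a / (k : ℝ) ^ α) : Summable fun k => step (k + 1) ^ 2 := by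
  have h1 : Summable fun k : ℕ => a ^ 2 * (1 / (k : ℝ) ^ (2 * α)) :=
    (Real.summable_one_div_nat_rpow.2 (by linarith)).mul_left _
  refine ((summable_nat_add_iff 1).2 h1).congr fun k => ?_
  have hk : (0 : ℝ) ≤ ((k + 1 : ℕ) : ℝ) := Nat.cast_nonneg _
  rw [hstep (k + 1) (by omega), div_pow, mul_comm 2 α, Real.rpow_mul hk, Real.rpow_ofNat,
    mul_one_div]

lemma not_summable_step {a α : ℝ} (ha : 0 < a) (hα : α < 1) {step : ℕ → ℝ}
    (hstep : ∀ k ≥ 1, step k = a / (k : ℝ) ^ α) : ¬ Summable fun k => step (k + 1) := by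
  intro h
  have h1 : Summable fun k : ℕ => 1 / ((k + 1 : ℕ) : ℝ) ^ α := by
    refine (h.mul_left a⁻¹).congr fun k => ?_
    rw [hstep (k + 1) (by omega)]
    field_simp
  have h2 := (summable_nat_add_iff (f := fun k : ℕ => 1 / (k : ℝ) ^ α) 1).1 h1
  have h3 := Real.summable_one_div_nat_rpow.1 h2
  linarith

/-! ### The expected gradient -/

/-- Both sides lie in the direction space, where it suffices to test against `y - x` with `y ∈ X`;
there it is differentiation under the integral. The unprojected identity may fail, as the chosen
gradients are arbitrary off that space. -/
lemma integral_starProjection_grad {m d : ℕ} {Ξ : Fin m → Type*} [∀ j, MeasurableSpace (Ξ j)]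
    {X : Set (Vec d)} (hX : Convex ℝ X) {F : (j : Fin m) → Vec d → Ξ j → ℝ}
    {gradF : (j : Fin m) → Vec d → Ξ j → Vec d} {ν : (j : Fin m) → Measure (Ξ j)}
    [∀ j, IsProbabilityMeasure (ν j)] (hobj : ObjectiveAssumption X F gradF ν)
    {gradf : Fin m → Vec d → Vec d} {j : Fin m} {x : Vec d} (hx : x ∈ X)
    (hf : HasGradientWithinAt (localObjective F ν j) (gradf j x) X x)
    (hint : Integrable (fun s => (vectorSpan ℝ X).starProjection (gradF j x s)) (ν j)) :
    ∫ s, (vectorSpan ℝ X).starProjection (gradF j x s) ∂(ν j) =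
      (vectorSpan ℝ X).starProjection (gradf j x) := by
  set P := (vectorSpan ℝ X).starProjection with hP
  have h1 : P (∫ s, P (gradF j x s) ∂(ν j)) = ∫ s, P (gradF j x s) ∂(ν j) := by
    rw [← P.integral_comp_comm hint]
    refine integral_congr_ae (Eventually.of_forall fun s => ?_)
    exact Submodule.starProjection_eq_self_iff.2 (Submodule.starProjection_apply_mem _ _)
  rw [← h1]
  refine starProjection_vectorSpan_eq hx fun y hy => ?_
  rw [← integral_inner_grad hX hobj hx hy hf, real_inner_comm, ← integral_inner hint]
  refine integral_congr_ae (Eventually.of_forall fun s => ?_)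
  simp only
  rw [real_inner_comm]
  exact inner_starProjection_vectorSpan hy hx _

end DDA

open DDA

theorem mainTheorem3 {m d d₁ d₂ : ℕ} (hm : 0 < m)
    {Ω : Type*} [MeasurableSpace Ω] (μ : Measure Ω) [IsProbabilityMeasure μ]
    {Ξ : Fin m → Type*} [∀ j, MeasurableSpace (Ξ j)] (ν : (j : Fin m) → Measure (Ξ j))
    (B : Matrix (Fin d₁) (Fin d) ℝ) (b : Fin d₁ → ℝ)
    (C : Matrix (Fin d₂) (Fin d) ℝ) (c : Fin d₂ → ℝ)
    (F : (j : Fin m) → DDA.Vec d → Ξ j → ℝ)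
    (gradF : (j : Fin m) → DDA.Vec d → Ξ j → DDA.Vec d)
    (gradf : Fin m → DDA.Vec d → DDA.Vec d)
    (hess : DDA.Vec d →L[ℝ] DDA.Vec d) (xstar : DDA.Vec d)
    (z₀ : Fin m → Ω → DDA.Vec d) (ξ : (j : Fin m) → ℕ → Ω → Ξ j)
    (A : ℕ → Ω → Matrix (Fin m) (Fin m) ℝ)
    (hopt : xstar ∈ DDA.optimalSet (DDA.objective F ν) (DDA.feasibleSet B b C c))
    (hactive : B *ᵥ xstar.ofLp = b) (hinactive : ∀ i, (C *ᵥ xstar.ofLp) i < c i)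
    (hobj : DDA.ObjectiveAssumption (DDA.feasibleSet B b C c) F gradF ν)
    (hreg : DDA.RegularityAssumption (DDA.feasibleSet B b C c) B F ν gradf hess xstar)
    (hnondeg : -(∑ j, gradf j xstar) ∈
      intrinsicInterior ℝ (DDA.normalCone (DDA.feasibleSet B b C c) xstar))
    (hsample : DDA.SampleAssumption μ ν z₀ ξ A)
    (hweight : DDA.WeightAssumption μ z₀ ξ A)
    (a α : ℝ) (ha : 0 < a) (hα : 2 / 3 < α) (hα' : α < 1)
    (step : ℕ → ℝ) (hstep : ∀ k ≥ 1, step k = a / (k : ℝ) ^ α) :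
    ∀ᵐ ω ∂μ, ∃ K ≥ 1, ∀ k ≥ K,
      B *ᵥ (DDA.primalAvg (DDA.feasibleSet B b C c) DDA.euclideanReg gradF step z₀ ξ A k ω).ofLp
          = b ∧
      ∀ i, (C *ᵥ (DDA.primalAvg (DDA.feasibleSet B b C c) DDA.euclideanReg gradF step z₀ ξ A
          k ω).ofLp) i < c i := by
  set X := feasibleSet B b C c with hXdef
  have hp : xstar ∈ X := hopt.1
  have hne : X.Nonempty := ⟨xstar, hp⟩
  have hcl : IsClosed X := isClosed_feasibleSet
  have hX : Convex ℝ X := convex_feasibleSet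
  have hνp : ∀ j, IsProbabilityMeasure (ν j) := fun j => by
    rw [← hsample.law j 1 le_rfl]
    exact Measure.isProbabilityMeasure_map (hsample.measurable j 1 le_rfl).aemeasurable
  set P := (vectorSpan ℝ X).starProjection with hP
  have hQP : ∀ z, mirrorMap euclideanReg X (P z) = mirrorMap euclideanReg X z :=
    mirrorMap_starProjection hne hcl hX
  obtain ⟨δ, hδ, hsharp⟩ := exists_sharp_of_mem_intrinsicInterior hactive hnondeg
  obtain ⟨η, hη, hloc⟩ := eventually_coupling_eq hp
  obtain ⟨K, hK0, hK⟩ := exists_norm_starProjection_grad_le hobj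
  choose q L₀ hq hL₀m hL₀ hL₀lip using hobj.lipschitz
  have hL₀2 : ∀ j, MemLp (fun s => K * |L₀ j s|) 2 (ν j) := by
    intro j
    have h2 : (2 : ENNReal) ≤ ENNReal.ofReal (q j) := by
      rw [← ENNReal.ofReal_ofNat]
      exact ENNReal.ofReal_le_ofReal (hq j)
    exact ((hL₀ j).mono_exponent h2).abs.const_mul K
  have hgm : ∀ j, Measurable fun r : Vec d × Ξ j =>
      P (gradF j (mirrorMap euclideanReg X r.1) r.2) := fun j =>
    P.continuous.measurable.comp (measurable_grad_mirrorMap hne hcl hX hobj j)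
  have hgb : ∀ j (y : Vec d) s, ‖P (gradF j (mirrorMap euclideanReg X y) s)‖ ≤ K * |L₀ j s| :=
    fun j y s => hK j (L₀ j) (hL₀lip j) s _ (mirrorMap_mem hne hcl hX y)
  have hG : ∀ j (y : Vec d), ∫ s, P (gradF j (mirrorMap euclideanReg X y) s) ∂(ν j) =
      P (gradf j (mirrorMap euclideanReg X y)) := by
    intro j y
    have hmem := mirrorMap_mem hne hcl hX y
    refine integral_starProjection_grad hX hobj hmem (hreg.hasGradient j _ hmem) ?_
    exact ((hL₀2 j).integrable one_le_two).mono'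
      (P.continuous.measurable.comp (measurable_grad_apply hobj j hmem)).aestronglyMeasurable
      (Eventually.of_forall (hgb j y))
  set 𝒢 := historyFiltration hsample.measurable_init hsample.measurable hweight.measurable
  -- Applied to the projected dual variables, which obey the same recursion with projected
  -- gradients. Index `k` here carries the weight, sample and step size of time `k + 1`.
  have hconv := ae_tendsto_mirrorMap_mean hm 𝒢 hcl hX hp hη hloc (f := localObjective F ν)
    (fun j => exists_lipschitz_localObjective hobj j) (fun x hx => hopt.2 hx)
    (fun x hx hfx => eq_of_isMinOn hp hobj hreg hopt.2 hδ hsharp hx hfx)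
    (A := fun k => A (k + 1)) (fun k => hweight.measurable _ k.succ_pos)
    (fun k => hweight.stochastic _ k.succ_pos) (fun k => hweight.indep_history _ k.succ_pos)
    (hweight.mixing 1 le_rfl)
    (fun k => (mixingNorm_eq_of_identDistrib (hweight.identDistrib _ k.succ_pos)).le)
    (ζ := fun j k => ξ j (k + 1))
    (fun j k => measurable_sample_history k.succ_pos (Nat.lt_succ_self _) j)
    (fun j k => hsample.law j _ k.succ_pos) (fun j k => hsample.fresh j _ k.succ_pos)
    (g := fun j y s => P (gradF j (mirrorMap euclideanReg X y) s)) hgm hL₀2 hgb hG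
    (fun j => by
      obtain ⟨L, hL, hL'⟩ := hreg.lipschitz j
      refine ⟨L, hL.le, fun y y' => ?_⟩
      rw [← map_sub]
      exact (Submodule.norm_starProjection_apply_le _ _).trans
        (hL' _ (mirrorMap_mem hne hcl hX y) _ (mirrorMap_mem hne hcl hX y')))
    (fun j y => by
      have hmem := mirrorMap_mem hne hcl hX y
      have h1 := add_inner_le_of_convexOn (convexOn_localObjective hX hobj j) hmem
        (hreg.hasGradient j _ hmem) hp
      rw [inner_starProjection_vectorSpan hmem hp]
      rw [← neg_sub, inner_neg_right] at h1
      linarith)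
    (y := fun k j ω => P (dual X euclideanReg gradF step z₀ ξ A k j ω))
    (fun k j => P.continuous.measurable.comp (measurable_dual hne hcl hX hobj step k j))
    (a := fun k => step (k + 1))
    (fun k => by rw [hstep _ k.succ_pos]; positivity)
    (not_summable_step ha hα' hstep) (summable_step_sq hα hstep)
    (fun k => by
      filter_upwards [hweight.stochastic (k + 1) k.succ_pos] with ω hω j
      have h1 : ∀ i, max (A (k + 1) ω j i) 0 = A (k + 1) ω j i := fun i =>
        max_eq_left (nonneg_of_mem_doublyStochastic hω)
      simp only [dual, sum_neighbors_smul, h1, hQP, map_sub, map_sum, map_smul])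
  -- The limiting direction is the projected mean gradient with a minus sign: the mean shrinks the
  -- sharpness constant by `m`, and the projection is invisible against `x - xstar`.
  have hsharp' : ∀ x ∈ X, (m : ℝ)⁻¹ * δ * ∑ l, |⟪rowVec B l, x - xstar⟫| ≤
      -⟪-mean fun j => P (gradf j (mirrorMap euclideanReg X xstar)), x - xstar⟫ := by
    intro x hx
    have h1 := mul_le_mul_of_nonneg_left (hsharp x hx)
      (inv_nonneg.2 (Nat.cast_nonneg m : (0 : ℝ) ≤ m))
    rw [mul_assoc]
    refine h1.trans (le_of_eq ?_)
    rw [mirrorMap_eq_self hcl hX hp, mean, ← map_sum, inner_neg_left, inner_neg_left,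
      real_inner_smul_left, inner_starProjection_vectorSpan hx hp, neg_neg, neg_neg]
  have hs : Tendsto (fun n => ∑ k ∈ Finset.range n, step (k + 1)) atTop atTop :=
    (not_summable_iff_tendsto_nat_atTop_of_nonneg
      fun k => by rw [hstep _ k.succ_pos]; positivity).1 (not_summable_step ha hα' hstep)
  filter_upwards [hconv] with ω hω
  have hev := eventually_active_of_tendsto hactive hinactive
    (mul_pos (inv_pos.2 (Nat.cast_pos.2 hm)) hδ) hsharp' hs hω.2 hω.1
  obtain ⟨N, hN⟩ := eventually_atTop.1 hev
  -- Shift by one because the averaged primal iterate of time `k` is computed from the dual average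
  -- of time `k - 1`.
  refine ⟨N + 1, by omega, fun k hk => ?_⟩
  have h1 : primalAvg X euclideanReg gradF step z₀ ξ A k ω = mirrorMap euclideanReg X
      (mean fun j => P (dual X euclideanReg gradF step z₀ ξ A (k - 1) j ω)) := by
    rw [primalAvg, ← hQP, dualAvg, mean, map_smul, map_sum]
  rw [h1]
  exact hN (k - 1) (by omega)
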